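/- Let $\mathfrak g=\mathfrak{gl}(m|n)$ be the complex general linear Lie superalgebra with matrix units $E_{ab}$, $1\le a,b\le m+n$, even part $\mathfrak g_0=\mathfrak{gl}_m\oplus\mathfrak{gl}_n$, and odd part $\mathfrak g_1=\mathfrak g_+\oplus\mathfrak g_-$, where $\mathfrak g_+$ has the basis $\partial_{(i,k)}=E_{ik}$ and $\mathfrak g_-$ the basis $x_{(i,k)}=E_{ki}$ ($i\le m<k$). Let $B(X,Y)=\tfrac12\operatorname{str}(XY)$, so that $B(\partial_p,x_q)=\tfrac12\delta_{pq}$. Let $M(\mathfrak g_1)=\mathbb C[x_p]$ be the polynomial algebra in the $mn$ variables $x_p$, on which the Weyl algebra $W(\mathfrak g_1)$ acts ($x_p$ by multiplication, $\partial_p$ as $\partial/\partial x_p$), and let $\mathfrak g_0$ act on it through the Lie algebra map $\alpha:\mathfrak g_0\to\mathfrak{sp}(\mathfrak g_1)\subset W(\mathfrak g_1)$, $$\alpha(X)=\sum_{p,q}\bigl(B(X,[\partial_p,\partial_q])x_px_q+B(X,[x_p,x_q])\partial_p\partial_q\bigr)-\sum_{p,q}2B(X,[x_p,\partial_q])x_q\partial_p-\sum_pB(X,[\partial_p,x_p]).$$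 Let $V$ be a $\mathbb Z/2$-graded $\mathfrak g$-module which is (a) a $(\mathfrak g,\mathfrak g_0)$-module: as a $\mathfrak g_0$-module it is a direct sum of finite-dimensional simple modules with finite multiplicities; (b) irreducible: it is nonzero and has no proper nonzero graded submodule; (c) unitary: it admits a positive definite Hermitian form with $\langle Xv,w\rangle=\langle v,\omega(X)w\rangle$ for all $X\in\mathfrak g$ and $v,w\in V$, where $\omega$ is the antilinear map with $\omega(E_{ab})=E_{ba}$. On $V\otimes M(\mathfrak g_1)$ consider the operators $$d=\sum_p\partial_p\otimes x_p,\qquad \delta=\sum_px_p\otimes\partial_p,\qquad D=2\sum_p(\partial_p\otimes x_p-x_p\otimes\partial_p)=2(d-\delta).$$ Then (i) $V\otimes M(\mathfrak g_1)=\operatorname{Ker}D\oplus\operatorname{Im}d\oplus\operatorname{Im}\delta$; (ii) $\operatorname{Ker}d=\operatorname{Ker}D\oplus\operatorname{Im}d$; (iii) $\operatorname{Ker}\delta=\operatorname{Ker}D\oplus\operatorname{Im}\delta$. In particular, there are isomorphisms of $\mathfrak g_0$-modules $$H_D(V)\;\cong\;H^*(\mathfrak g_+,V)\otimes\mathbb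 C_{-\rho_1}\;\cong\;H_*(\mathfrak g_-,V)\otimes\mathbb C_{-\rho_1}.$$ Here $H_D(V)=\operatorname{Ker}D/(\operatorname{Ker}D\cap\operatorname{Im}D)$ is the Dirac cohomology, with $X\in\mathfrak g_0$ acting by $X\otimes1+1\otimes\alpha(X)$. The module $H^*(\mathfrak g_+,V)=\bigoplus_iH^i(\mathfrak g_+,V)$ is the cohomology of the complex $(V\otimes S^i(\mathfrak g_+^*))_i$ with differential $d$, where $\mathfrak g_+^*$ is identified with $\mathfrak g_-$ by the pairing $2B$ and $S(\mathfrak g_-)$ with $\mathbb C[x_p]$. The module $H_*(\mathfrak g_-,V)=\bigoplus_iH_i(\mathfrak g_-,V)$ is the homology of the complex $(V\otimes S^i(\mathfrak g_-))_i$ with differential $\delta$. In both, $\mathfrak g_0$ acts on $S(\mathfrak g_-)$ by the adjoint action. Finally, $\mathbb C_{-\rho_1}$ is the one-dimensional $\mathfrak g_0$-module of weight $-\rho_1$, with $\rho_1$ half the sum of the odd positive roots $\varepsilon_i-\varepsilon_k$ ($i\le m<k$). -/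

import Mathlib

open scoped TensorProduct

noncomputable section

attribute [local instance] LieRing.ofAssociativeRing

/-! ### Representations of a complex Lie algebra -/

section LieReps

variable {L : Type*} [LieRing L] [LieAlgebra ℂ L]

/-- Isomorphism of representations of a Lie algebra. -/
def RepIso {E F : Type*} [AddCommGroup E] [Module ℂ E] [AddCommGroup F] [Module ℂ F]
    (ρ : L →ₗ⁅ℂ⁆ Module.End ℂ E) (σ : L →ₗ⁅ℂ⁆ Module.End ℂ F) : Prop :=
  ∃ φ : E ≃ₗ[ℂ] F, ∀ (X : L) (v : E), φ (ρ X v) = σ X (φ v)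

/-- The subspace `W` is a subrepresentation. -/
def IsStable {E : Type*} [AddCommGroup E] [Module ℂ E]
    (ρ : L →ₗ⁅ℂ⁆ Module.End ℂ E) (W : Submodule ℂ E) : Prop :=
  ∀ (X : L), ∀ v ∈ W, ρ X v ∈ W

/-- The representation on a subrepresentation. -/
def subRep {E : Type*} [AddCommGroup E] [Module ℂ E]
    (ρ : L →ₗ⁅ℂ⁆ Module.End ℂ E) (W : Submodule ℂ E) (hW : IsStable ρ W) :
    L →ₗ⁅ℂ⁆ Module.End ℂ W where
  toFun X := (ρ X).restrict (hW X)
  map_add' X Y := by ext v; simp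
  map_smul' c X := by ext v; simp
  map_lie' {X Y} := by ext v; simp [LieRing.of_associative_ring_bracket]

/-- The subquotient `Z / (B ∩ Z)`. -/
def SubQuot {E : Type*} [AddCommGroup E] [Module ℂ E] (Z B : Submodule ℂ E) :=
  Z ⧸ B.submoduleOf Z

instance {E : Type*} [AddCommGroup E] [Module ℂ E] (Z B : Submodule ℂ E) :
    AddCommGroup (SubQuot Z B) :=
  inferInstanceAs (AddCommGroup (Z ⧸ B.submoduleOf Z))

instance {E : Type*} [AddCommGroup E] [Module ℂ E] (Z B : Submodule ℂ E) :
    Module ℂ (SubQuot Z B) :=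
  inferInstanceAs (Module ℂ (Z ⧸ B.submoduleOf Z))

/-- The class in `Z / (B ∩ Z)` of an element of `Z`. -/
def SubQuot.mk {E : Type*} [AddCommGroup E] [Module ℂ E] (Z B : Submodule ℂ E) :
    Z →ₗ[ℂ] SubQuot Z B :=
  (B.submoduleOf Z).mkQ

/-- The representation on the subquotient `Z / (B ∩ Z)`, for subrepresentations `Z`, `B`. -/
def subquotRep {E : Type*} [AddCommGroup E] [Module ℂ E]
    (ρ : L →ₗ⁅ℂ⁆ Module.End ℂ E) (Z B : Submodule ℂ E)
    (hZ : IsStable ρ Z) (hB : IsStable ρ B) :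
    L →ₗ⁅ℂ⁆ Module.End ℂ (SubQuot Z B) where
  toFun X := (B.submoduleOf Z).mapQ (B.submoduleOf Z) (subRep ρ Z hZ X)
    (fun v hv => hB X v hv)
  map_add' X Y := by
    apply LinearMap.ext
    rintro ⟨v⟩
    exact congrArg (SubQuot.mk Z B) (LinearMap.congr_fun (map_add (subRep ρ Z hZ) X Y) v)
  map_smul' c X := by
    apply LinearMap.ext
    rintro ⟨v⟩
    exact congrArg (SubQuot.mk Z B) (LinearMap.congr_fun (map_smul (subRep ρ Z hZ) c X) v)
  map_lie' {X Y} := by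
    apply LinearMap.ext
    rintro ⟨v⟩
    exact congrArg (SubQuot.mk Z B) (LinearMap.congr_fun (LieHom.map_lie (subRep ρ Z hZ) X Y) v)

/-- The tensor product of two representations, `X ↦ X ⊗ 1 + 1 ⊗ X`. -/
def tensorRep {E F : Type*} [AddCommGroup E] [Module ℂ E] [AddCommGroup F] [Module ℂ F]
    (ρ : L →ₗ⁅ℂ⁆ Module.End ℂ E) (σ : L →ₗ⁅ℂ⁆ Module.End ℂ F) :
    L →ₗ⁅ℂ⁆ Module.End ℂ (E ⊗[ℂ] F) where
  toFun X := TensorProduct.map (ρ X) LinearMap.id + TensorProduct.map LinearMap.id (σ X)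
  map_add' X Y := by
    ext v w; simp [TensorProduct.add_tmul, TensorProduct.tmul_add]; abel
  map_smul' c X := by
    ext v w; simp [TensorProduct.smul_tmul', TensorProduct.tmul_smul]
  map_lie' {X Y} := by
    ext v w
    simp [LieRing.of_associative_ring_bracket, TensorProduct.sub_tmul, TensorProduct.tmul_sub]
    abel

/-- The direct sum of a family of representations. -/
def directSumRep {E : ℕ → Type*} [∀ i, AddCommGroup (E i)] [∀ i, Module ℂ (E i)]
    (ρ : ∀ i, L →ₗ⁅ℂ⁆ Module.End ℂ (E i)) :
    L →ₗ⁅ℂ⁆ Module.End ℂ (DirectSum ℕ E) where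
  toFun X := DirectSum.lmap (fun i => ρ i X)
  map_add' X Y := by ext i v j; simp [DirectSum.lmap_lof]
  map_smul' c X := by ext i v j; simp [DirectSum.lmap_lof]
  map_lie' {X Y} := by
    ext i v j; simp [LieRing.of_associative_ring_bracket, DirectSum.lmap_lof]

/-- A simple representation. -/
def IsSimpleRep {E : Type*} [AddCommGroup E] [Module ℂ E]
    (ρ : L →ₗ⁅ℂ⁆ Module.End ℂ E) : Prop :=
  Nontrivial E ∧ ∀ W : Submodule ℂ E, IsStable ρ W → W = ⊥ ∨ W = ⊤

/-- A representation that is a direct sum of finite-dimensional simple subrepresentations, each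
isomorphism type occurring finitely often. -/
def IsAdmissibleRep {E : Type*} [AddCommGroup E] [Module ℂ E]
    (ρ : L →ₗ⁅ℂ⁆ Module.End ℂ E) : Prop :=
  ∃ (S : Set (Submodule ℂ E)) (hS : ∀ W : S, IsStable ρ W.1),
    sSupIndep S ∧ sSup S = ⊤ ∧
    (∀ W : S, FiniteDimensional ℂ W.1 ∧ IsSimpleRep (subRep ρ W.1 (hS W))) ∧
    ∀ W : S, {W' : S | RepIso (subRep ρ W.1 (hS W)) (subRep ρ W'.1 (hS W'))}.Finite

lemma isStable_ker {E F : Type*} [AddCommGroup E] [Module ℂ E] [AddCommGroup F] [Module ℂ F]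
    {ρ : L →ₗ⁅ℂ⁆ Module.End ℂ E} {σ : L →ₗ⁅ℂ⁆ Module.End ℂ F} (T : E →ₗ[ℂ] F)
    (h : ∀ X v, T (ρ X v) = σ X (T v)) : IsStable ρ (LinearMap.ker T) := by
  intro X v hv
  rw [LinearMap.mem_ker] at hv ⊢
  rw [h, hv, map_zero]

lemma isStable_map {E F : Type*} [AddCommGroup E] [Module ℂ E] [AddCommGroup F] [Module ℂ F]
    {ρ : L →ₗ⁅ℂ⁆ Module.End ℂ E} {σ : L →ₗ⁅ℂ⁆ Module.End ℂ F} (T : E →ₗ[ℂ] F)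
    (h : ∀ X v, T (ρ X v) = σ X (T v)) {W : Submodule ℂ E} (hW : IsStable ρ W) :
    IsStable σ (W.map T) := by
  rintro X _ ⟨v, hv, rfl⟩
  exact ⟨ρ X v, hW X v hv, h X v⟩

lemma isStable_inf {E : Type*} [AddCommGroup E] [Module ℂ E]
    {ρ : L →ₗ⁅ℂ⁆ Module.End ℂ E} {W W' : Submodule ℂ E} (h : IsStable ρ W)
    (h' : IsStable ρ W') : IsStable ρ (W ⊓ W') :=
  fun X v hv => ⟨h X v hv.1, h' X v hv.2⟩

lemma isStable_range {E : Type*} [AddCommGroup E] [Module ℂ E]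
    {ρ : L →ₗ⁅ℂ⁆ Module.End ℂ E} (T : E →ₗ[ℂ] E)
    (h : ∀ X v, T (ρ X v) = ρ X (T v)) : IsStable ρ (LinearMap.range T) := by
  rintro X _ ⟨v, rfl⟩
  exact ⟨ρ X v, h X v⟩

end LieReps

/-! ### The general linear Lie superalgebra `𝔤 = 𝔤𝔩(m|n)` -/

/-- The underlying vector space of `𝔤𝔩(m|n)`; `Sum.inl i` stands for the index `i ≤ m` and
`Sum.inr k` for the index `m + k`. -/
abbrev SGL (m n : ℕ) := Matrix (Fin m ⊕ Fin n) (Fin m ⊕ Fin n) ℂ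

variable {m n : ℕ}

/-- Parity of an index. -/
def par : Fin m ⊕ Fin n → ZMod 2 := Sum.elim (fun _ => 0) (fun _ => 1)

/-- The homogeneous part of `𝔤𝔩(m|n)` of parity `p`. -/
def glPart (m n : ℕ) (p : ZMod 2) : Submodule ℂ (SGL m n) where
  carrier := {X | ∀ i j, par i + par j ≠ p → X i j = 0}
  add_mem' hX hY i j h := by simp [hX i j h, hY i j h]
  zero_mem' i j _ := rfl
  smul_mem' c X hX i j h := by simp [hX i j h]

/-- The homogeneous component of parity `p` of a matrix. -/
def homComp (p : ZMod 2) (X : SGL m n) : SGL m n :=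
  Matrix.of fun i j => if par i + par j = p then X i j else 0

/-- The sign `(-1)^{pq}`. -/
def superSign (p q : ZMod 2) : ℂ := if p = 1 ∧ q = 1 then -1 else 1

/-- The superbracket, the bilinear map with `[X, Y] = XY - (-1)^{pq} YX` for `X`, `Y`
homogeneous of parities `p`, `q`. -/
def superBracket (X Y : SGL m n) : SGL m n :=
  ∑ p : ZMod 2, ∑ q : ZMod 2,
    (homComp p X * homComp q Y - superSign p q • (homComp q Y * homComp p X))

/-- The supertrace. -/
def str (X : SGL m n) : ℂ :=
  ∑ i : Fin m, X (Sum.inl i) (Sum.inl i) - ∑ k : Fin n, X (Sum.inr k) (Sum.inr k)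

/-- The invariant form `B(X, Y) = (1/2) str(XY)`. -/
def formB (X Y : SGL m n) : ℂ := (1 / 2) * str (X * Y)

/-- The basis vector `∂_(i,k) = E_{i, m+k}` of `𝔤₊`. -/
def dE (p : Fin m × Fin n) : SGL m n := Matrix.single (Sum.inl p.1) (Sum.inr p.2) 1

/-- The basis vector `x_(i,k) = E_{m+k, i}` of `𝔤₋`. -/
def xE (p : Fin m × Fin n) : SGL m n := Matrix.single (Sum.inr p.2) (Sum.inl p.1) 1

/-- The even part `𝔤₀` as a Lie algebra (block diagonal matrices with the commutator). -/
def g0 (m n : ℕ) : LieSubalgebra ℂ (SGL m n) where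
  __ := glPart m n 0
  lie_mem' {X Y} hX hY := by
    intro i j h
    have hm : ∀ X Y : SGL m n, X ∈ glPart m n 0 → Y ∈ glPart m n 0 → (X * Y) i j = 0 := by
      intro X Y hX hY
      rw [Matrix.mul_apply]
      refine Finset.sum_eq_zero fun k _ => ?_
      by_cases h1 : par i + par k = 0
      · have h2 : par k + par j ≠ 0 := by
          intro h2
          apply h
          generalize par i = a at *
          generalize par j = b at *
          generalize par k = c at *
          revert a b c; decide
        rw [hY k j h2, mul_zero]
      · rw [hX i k h1, zero_mul]
    rw [LieRing.of_associative_ring_bracket, Matrix.sub_apply, hm X Y hX hY, hm Y X hY hX, sub_zero]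

/-! ### `𝔤`-modules -/

/-- A `ℤ/2`-graded representation of the Lie superalgebra `𝔤𝔩(m|n)` on `V`. -/
structure GLRep (m n : ℕ) (V : Type*) [AddCommGroup V] [Module ℂ V] where
  /-- the action -/
  act : SGL m n →ₗ[ℂ] Module.End ℂ V
  /-- the grading -/
  gr : ZMod 2 → Submodule ℂ V
  gr_internal : DirectSum.IsInternal gr
  act_mem : ∀ p q, ∀ X ∈ glPart m n p, ∀ v ∈ gr q, act X v ∈ gr (p + q)
  act_bracket : ∀ p q, ∀ X ∈ glPart m n p, ∀ Y ∈ glPart m n q,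
    act (superBracket X Y) = act X * act Y - superSign p q • (act Y * act X)

lemma homComp_of_mem {p : ZMod 2} {X : SGL m n} (hX : X ∈ glPart m n p) (q : ZMod 2) :
    homComp q X = if q = p then X else 0 := by
  ext i j
  by_cases hq : q = p
  · subst hq
    by_cases h : par i + par j = q
    · simp [homComp, h]
    · simp [homComp, h, hX i j h]
  · by_cases h : par i + par j = q
    · have : par i + par j ≠ p := fun h' => hq (h.symm.trans h')
      simp [homComp, hq, hX i j this]
    · simp [homComp, h, hq]

lemma superBracket_of_mem {p q : ZMod 2} {X Y : SGL m n} (hX : X ∈ glPart m n p)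
    (hY : Y ∈ glPart m n q) :
    superBracket X Y = X * Y - superSign p q • (Y * X) := by
  unfold superBracket
  rw [Finset.sum_eq_single p, Finset.sum_eq_single q]
  · simp [homComp_of_mem hX, homComp_of_mem hY]
  · intro b _ hb; simp [homComp_of_mem hY, hb]
  · simp
  · intro b _ hb; simp [homComp_of_mem hX, hb]
  · simp

lemma dE_mem (p : Fin m × Fin n) : dE p ∈ glPart m n 1 := by
  intro i j h
  rcases i with i | i <;> rcases j with j | j <;> simp_all [dE, par]

lemma xE_mem (p : Fin m × Fin n) : xE p ∈ glPart m n 1 := by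
  intro i j h
  rcases i with i | i <;> rcases j with j | j <;> simp_all [xE, par]

section Modules

variable {V : Type*} [AddCommGroup V] [Module ℂ V]

lemma GLRep.act_lie_even (R : GLRep m n V) (q : ZMod 2) {X Y : SGL m n}
    (hX : X ∈ glPart m n 0) (hY : Y ∈ glPart m n q) :
    R.act (X * Y - Y * X) = R.act X * R.act Y - R.act Y * R.act X := by
  have h := R.act_bracket 0 q X hX Y hY
  rw [superBracket_of_mem hX hY] at h
  simpa [superSign] using h

/-- The restriction of `V` to `𝔤₀`. -/
def GLRep.even (R : GLRep m n V) : g0 m n →ₗ⁅ℂ⁆ Module.End ℂ V where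
  toFun X := R.act X.1
  map_add' X Y := by simp
  map_smul' c X := by simp
  map_lie' {X Y} := by
    rw [LieRing.of_associative_ring_bracket]
    exact R.act_lie_even 0 X.2 Y.2

/-- `V` is a `(𝔤, 𝔤₀)`-module. -/
def GLRep.IsRelModule (R : GLRep m n V) : Prop := IsAdmissibleRep R.even

/-- `V` is irreducible: nonzero, without proper nonzero graded submodules. -/
def GLRep.IsIrred (R : GLRep m n V) : Prop :=
  Nontrivial V ∧ ∀ W : Submodule ℂ V, W = ⨆ p, W ⊓ R.gr p →
    (∀ X, ∀ v ∈ W, R.act X v ∈ W) → W = ⊥ ∨ W = ⊤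

/-- `V` is unitary: it admits a positive definite Hermitian form, contravariant for the antilinear
anti-involution `E_{ij} ↦ E_{ji}`, that is, `X ↦ Xᴴ`. -/
def GLRep.IsUnitary (R : GLRep m n V) : Prop :=
  ∃ h : V →ₗ⋆[ℂ] V →ₗ[ℂ] ℂ,
    (∀ v w, starRingEnd ℂ (h v w) = h w v) ∧
    (∀ v, v ≠ 0 → 0 < (h v v).re) ∧
    ∀ (X : SGL m n) (v w : V), h (R.act X v) w = h v (R.act X.conjTranspose w)

end Modules

/-! ### Polynomials in the variables `x_(i,k)`, and two actions of `𝔤₀` on them -/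

/-- `ℂ[x_1, …, x_{mn}]`, identified with `S(𝔤₋)`; the variable `x_(i,k)` is the element
`E_{m+k, i}` of `𝔤₋`. It also is the space of the Weil representation `M(𝔤₁)` of the Weyl algebra
`W(𝔤₁)`, in which `x_(i,k)` acts by multiplication and `∂_(i,k)` by `∂/∂x_(i,k)`. -/
abbrev PolyX (m n : ℕ) := MvPolynomial (Fin m × Fin n) ℂ

/-- Multiplication by a variable. -/
def mulX (p : Fin m × Fin n) : Module.End ℂ (PolyX m n) := LinearMap.mulLeft ℂ (MvPolynomial.X p)

/-- Partial derivative. -/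
def dX (p : Fin m × Fin n) : Module.End ℂ (PolyX m n) := (MvPolynomial.pderiv p).toLinearMap

/-- An element of `𝔤₋` as a linear polynomial. -/
def linPoly (Z : SGL m n) : PolyX m n :=
  ∑ q : Fin m × Fin n, Z (Sum.inr q.2) (Sum.inl q.1) • MvPolynomial.X q

/-- For `X ∈ 𝔤₀`, the derivation of `S(𝔤₋)` that extends `ad X` on `𝔤₋`. -/
def adDer (X : SGL m n) : Derivation ℂ (PolyX m n) (PolyX m n) :=
  MvPolynomial.mkDerivation ℂ fun p => linPoly (superBracket X (xE p))

/-- The operator on `M(𝔤₁)` given by the element `α(X)` of the Weyl algebra, where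
`α : 𝔤₀ → 𝔰𝔭(𝔤₁) → W(𝔤₁)`. -/
def alphaOp (X : SGL m n) : Module.End ℂ (PolyX m n) :=
  ∑ p : Fin m × Fin n, ∑ q : Fin m × Fin n,
      (formB X (superBracket (dE p) (dE q)) • (mulX p * mulX q)
        + formB X (superBracket (xE p) (xE q)) • (dX p * dX q))
    - ∑ p : Fin m × Fin n, ∑ q : Fin m × Fin n,
        (2 * formB X (superBracket (xE p) (dE q))) • (mulX q * dX p)
    - ∑ p : Fin m × Fin n, formB X (superBracket (dE p) (xE p)) • (1 : Module.End ℂ (PolyX m n))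

/-- The weight `ρ₁`, half the sum of the odd positive roots `ε_i - ε_{m+k}`, as a function of the
diagonal entries. -/
def rhoOne (X : SGL m n) : ℂ :=
  (1 / 2) * ∑ p : Fin m × Fin n, (X (Sum.inl p.1) (Sum.inl p.1) - X (Sum.inr p.2) (Sum.inr p.2))


section Aux

lemma linPoly_add (Z W : SGL m n) : linPoly (Z + W) = linPoly Z + linPoly W := by
  simp [linPoly, add_smul, Finset.sum_add_distrib]

lemma linPoly_smul (c : ℂ) (Z : SGL m n) : linPoly (c • Z) = c • linPoly Z := by
  simp [linPoly, Finset.smul_sum, smul_smul]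

lemma linPoly_sub (Z W : SGL m n) : linPoly (Z - W) = linPoly Z - linPoly W := by
  simp [linPoly, sub_smul, Finset.sum_sub_distrib]

lemma even_lr {X : SGL m n} (hX : X ∈ glPart m n 0) (i : Fin m) (k : Fin n) :
    X (Sum.inl i) (Sum.inr k) = 0 := hX _ _ (by simp [par])

lemma even_rl {X : SGL m n} (hX : X ∈ glPart m n 0) (i : Fin m) (k : Fin n) :
    X (Sum.inr k) (Sum.inl i) = 0 := hX _ _ (by simp [par])

lemma bracket_even {X Y : SGL m n} {q : ZMod 2} (hX : X ∈ glPart m n 0)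
    (hY : Y ∈ glPart m n q) : superBracket X Y = X * Y - Y * X := by
  rw [superBracket_of_mem hX hY]; simp [superSign]

lemma bracket_odd {X Y : SGL m n} (hX : X ∈ glPart m n 1)
    (hY : Y ∈ glPart m n 1) : superBracket X Y = X * Y + Y * X := by
  rw [superBracket_of_mem hX hY]; simp [superSign]

/-- The matrix of `ad X` on `𝔤₋`. -/
def adCoef (X : SGL m n) (p q : Fin m × Fin n) : ℂ :=
  (if p.1 = q.1 then X (Sum.inr q.2) (Sum.inr p.2) else 0)
    - (if p.2 = q.2 then X (Sum.inl p.1) (Sum.inl q.1) else 0)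

lemma bracket_xE {X : SGL m n} (hX : X ∈ glPart m n 0) (p : Fin m × Fin n) :
    superBracket X (xE p) = ∑ q, adCoef X p q • xE q := by
  rw [bracket_even hX (xE_mem p)]
  ext a b
  rcases a with a | a <;> rcases b with b | b <;>
    simp [xE, Matrix.sum_apply, Matrix.single_apply, Matrix.mul_apply, adCoef, even_lr hX,
      Fintype.sum_prod_type, ite_and, Finset.sum_ite_eq]

lemma bracket_dE {X : SGL m n} (hX : X ∈ glPart m n 0) (p : Fin m × Fin n) :
    dE p * X - X * dE p = ∑ q, adCoef X q p • dE q := by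
  ext a b
  rcases a with a | a <;> rcases b with b | b <;>
    simp [dE, Matrix.sum_apply, Matrix.single_apply, Matrix.mul_apply, adCoef, even_rl hX,
      Fintype.sum_prod_type, ite_and, Finset.sum_ite_eq, @eq_comm _ p.1, @eq_comm _ p.2]

lemma linPoly_sum {ι : Type*} (s : Finset ι) (f : ι → SGL m n) :
    linPoly (∑ a ∈ s, f a) = ∑ a ∈ s, linPoly (f a) := by
  classical
  induction s using Finset.induction_on with
  | empty => simp [linPoly]
  | insert a s ha ih => rw [Finset.sum_insert ha, Finset.sum_insert ha, linPoly_add, ih]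

lemma linPoly_xE (p : Fin m × Fin n) : linPoly (xE p) = (MvPolynomial.X p : PolyX m n) := by
  unfold linPoly
  rw [Finset.sum_eq_single p]
  · simp [xE]
  · intro q _ hq
    have : ¬ (p.2 = q.2 ∧ p.1 = q.1) := fun h => hq (Prod.ext h.2.symm h.1.symm)
    simp [xE, this]
  · simp

lemma adDer_X {X : SGL m n} (hX : X ∈ glPart m n 0) (p : Fin m × Fin n) :
    adDer X (MvPolynomial.X p) = ∑ q, adCoef X p q • (MvPolynomial.X q : PolyX m n) := by
  rw [adDer, MvPolynomial.mkDerivation_X, bracket_xE hX, linPoly_sum]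
  simp [linPoly_smul, linPoly_xE]

lemma der_sum_apply {ι : Type*} (s : Finset ι)
    (D : ι → Derivation ℂ (PolyX m n) (PolyX m n)) (f : PolyX m n) :
    (∑ a ∈ s, D a) f = ∑ a ∈ s, D a f := by
  classical
  induction s using Finset.induction_on with
  | empty => simp
  | insert a s ha ih => rw [Finset.sum_insert ha, Finset.sum_insert ha, Derivation.add_apply, ih]

lemma adDer_apply {X : SGL m n} (hX : X ∈ glPart m n 0) (f : PolyX m n) :
    adDer X f = ∑ p, ∑ q, adCoef X p q • (MvPolynomial.X q * MvPolynomial.pderiv p f) := by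
  have h : adDer X = ∑ p, ∑ q, (adCoef X p q • (MvPolynomial.X q : PolyX m n)) •
      (MvPolynomial.pderiv p : Derivation ℂ (PolyX m n) (PolyX m n)) := by
    refine MvPolynomial.derivation_ext fun r => ?_
    rw [adDer_X hX]
    simp only [der_sum_apply, Derivation.smul_apply, MvPolynomial.pderiv_X]
    symm
    refine (Finset.sum_eq_single r ?_ ?_).trans ?_
    · intro b _ hb
      simp [Pi.single_eq_of_ne hb.symm]
    · simp
    · simp
  rw [h]
  simp [der_sum_apply]

lemma adCoef_add (X Y : SGL m n) (p q : Fin m × Fin n) :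
    adCoef (X + Y) p q = adCoef X p q + adCoef Y p q := by
  simp only [adCoef, Matrix.add_apply]; split_ifs <;> ring

lemma adCoef_smul (c : ℂ) (X : SGL m n) (p q : Fin m × Fin n) :
    adCoef (c • X) p q = c * adCoef X p q := by
  simp only [adCoef, Matrix.smul_apply, smul_eq_mul]; split_ifs <;> ring

lemma lie_mem_even {X Y : SGL m n} (hX : X ∈ glPart m n 0) (hY : Y ∈ glPart m n 0) :
    X * Y - Y * X ∈ glPart m n 0 := (g0 m n).lie_mem hX hY

lemma adCoef_lie {X Y : SGL m n} (hX : X ∈ glPart m n 0) (hY : Y ∈ glPart m n 0)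
    (p r : Fin m × Fin n) :
    adCoef (X * Y - Y * X) p r
      = ∑ q, (adCoef Y p q * adCoef X q r - adCoef X p q * adCoef Y q r) := by
  have h : superBracket (X * Y - Y * X) (xE p)
      = X * superBracket Y (xE p) - superBracket Y (xE p) * X
        - (Y * superBracket X (xE p) - superBracket X (xE p) * Y) := by
    rw [bracket_even (lie_mem_even hX hY) (xE_mem p), bracket_even hX (xE_mem p),
      bracket_even hY (xE_mem p)]
    noncomm_ring
  have key : ∀ Z W : SGL m n, Z ∈ glPart m n 0 → W ∈ glPart m n 0 →
      Z * superBracket W (xE p) - superBracket W (xE p) * Z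
        = ∑ q, ∑ r, (adCoef W p q * adCoef Z q r) • xE r := by
    intro Z W hZ hW
    rw [bracket_xE hW, Finset.mul_sum, Finset.sum_mul, ← Finset.sum_sub_distrib]
    refine Finset.sum_congr rfl fun q _ => ?_
    rw [mul_smul_comm, smul_mul_assoc, ← smul_sub, ← bracket_even hZ (xE_mem q), bracket_xE hZ,
      Finset.smul_sum]
    simp [smul_smul]
  rw [bracket_xE (lie_mem_even hX hY), key X Y hX hY, key Y X hY hX, Finset.sum_comm,
    Finset.sum_comm (f := fun q r => (adCoef X p q * adCoef Y q r) • xE r)] at h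
  have h' := congrFun (congrFun h (Sum.inr r.2)) (Sum.inl r.1)
  have ev : ∀ c : Fin m × Fin n → ℂ,
      (∑ q, c q • (xE q : SGL m n)) (Sum.inr r.2) (Sum.inl r.1) = c r := by
    intro c
    rw [Matrix.sum_apply, Finset.sum_eq_single r]
    · simp [xE]
    · intro q _ hq
      have : ¬ (q.2 = r.2 ∧ q.1 = r.1) := fun h => hq (Prod.ext h.2 h.1)
      simp [xE, this]
    · simp
  rw [ev] at h'
  rw [h', Matrix.sub_apply]
  simp only [← Finset.sum_smul]
  rw [ev, ev, Finset.sum_sub_distrib]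

lemma adDer_lie {X Y : SGL m n} (hX : X ∈ glPart m n 0) (hY : Y ∈ glPart m n 0) :
    adDer (X * Y - Y * X) = ⁅adDer X, adDer Y⁆ := by
  refine MvPolynomial.derivation_ext fun p => ?_
  rw [Derivation.commutator_apply, adDer_X hX, adDer_X hY, adDer_X (lie_mem_even hX hY)]
  simp only [map_sum, Derivation.map_smul, adDer_X hX, adDer_X hY, Finset.smul_sum, smul_smul]
  rw [Finset.sum_comm (f := fun q r => (adCoef Y p q * adCoef X q r) • MvPolynomial.X r),
    Finset.sum_comm (f := fun q r => (adCoef X p q * adCoef Y q r) • MvPolynomial.X r),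
    ← Finset.sum_sub_distrib]
  refine Finset.sum_congr rfl fun r _ => ?_
  rw [adCoef_lie hX hY, Finset.sum_smul, ← Finset.sum_sub_distrib]
  exact Finset.sum_congr rfl fun q _ => sub_smul _ _ _

lemma bracket_dE_dE (p q : Fin m × Fin n) : superBracket (dE p) (dE q) = 0 := by
  rw [bracket_odd (dE_mem p) (dE_mem q)]; simp [dE]

lemma bracket_xE_xE (p q : Fin m × Fin n) : superBracket (xE p) (xE q) = 0 := by
  rw [bracket_odd (xE_mem p) (xE_mem q)]; simp [xE]

lemma str_mul_xd (X : SGL m n) (p q : Fin m × Fin n) :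
    2 * formB X (superBracket (xE p) (dE q)) = - adCoef X p q := by
  rw [bracket_odd (xE_mem p) (dE_mem q), formB, str]
  simp [xE, dE, adCoef, Matrix.mul_add, Matrix.mul_apply, Matrix.single_apply, Matrix.add_apply,
    ite_and, Finset.sum_add_distrib, Finset.sum_ite_eq, @eq_comm _ q.1, @eq_comm _ q.2]

lemma formB_dx (X : SGL m n) (p : Fin m × Fin n) :
    formB X (superBracket (dE p) (xE p))
      = (1 / 2) * (X (Sum.inl p.1) (Sum.inl p.1) - X (Sum.inr p.2) (Sum.inr p.2)) := by
  rw [bracket_odd (dE_mem p) (xE_mem p), formB, str]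
  simp [xE, dE, Matrix.mul_add, Matrix.mul_apply, Matrix.single_apply, Matrix.add_apply,
    ite_and, Finset.sum_add_distrib, Finset.sum_ite_eq]

lemma alphaOp_eq {X : SGL m n} (hX : X ∈ glPart m n 0) :
    alphaOp X = (adDer X).toLinearMap - rhoOne X • 1 := by
  apply LinearMap.ext
  intro f
  have h0 : formB X 0 = 0 := by simp [formB, str]
  have hs : (2 : ℂ)⁻¹ * ∑ p : Fin m × Fin n,
      (X (Sum.inl p.1) (Sum.inl p.1) - X (Sum.inr p.2) (Sum.inr p.2))
      = ∑ p : Fin m × Fin n, formB X (superBracket (dE p) (xE p)) := by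
    simp only [formB_dx, Finset.mul_sum, one_div]
  simp only [alphaOp, bracket_dE_dE, bracket_xE_xE, str_mul_xd, LinearMap.sub_apply, rhoOne, one_div,
    hs, Derivation.coeFn_coe, adDer_apply hX, h0]
  simp [mulX, dX, LinearMap.sum_apply, Finset.sum_smul]

end Aux

/-- `ℂ[x_1, …, x_{mn}] = S(𝔤₋)` as a `𝔤₀`-module, with the adjoint action. -/
def adRep (m n : ℕ) : g0 m n →ₗ⁅ℂ⁆ Module.End ℂ (PolyX m n) where
  toFun X := (adDer X.1).toLinearMap
  map_add' X Y := by
    have h : adDer (X.1 + Y.1) = adDer X.1 + adDer Y.1 := by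
      refine MvPolynomial.derivation_ext fun p => ?_
      rw [Derivation.add_apply, adDer_X X.2, adDer_X Y.2, adDer_X ((g0 m n).add_mem X.2 Y.2)]
      simp [adCoef_add, add_smul, Finset.sum_add_distrib]
    apply LinearMap.ext; intro f
    exact congrArg (fun D : Derivation ℂ (PolyX m n) (PolyX m n) => D f) h
  map_smul' c X := by
    have h : adDer (c • X.1) = c • adDer X.1 := by
      refine MvPolynomial.derivation_ext fun p => ?_
      rw [Derivation.smul_apply, adDer_X X.2, adDer_X ((g0 m n).smul_mem c X.2)]
      simp [adCoef_smul, mul_smul, Finset.smul_sum]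
    apply LinearMap.ext; intro f
    exact congrArg (fun D : Derivation ℂ (PolyX m n) (PolyX m n) => D f) h
  map_lie' {X Y} := by
    have h := adDer_lie X.2 Y.2
    apply LinearMap.ext; intro f
    have h' := congrArg (fun D : Derivation ℂ (PolyX m n) (PolyX m n) => D f) h
    simpa [LieRing.of_associative_ring_bracket, Derivation.commutator_apply] using h'

lemma rhoOne_lie {X Y : SGL m n} (hX : X ∈ glPart m n 0) (hY : Y ∈ glPart m n 0) :
    rhoOne (X * Y - Y * X) = 0 := by
  have e1 : ∑ i : Fin m, ∑ j : Fin m, X (Sum.inl i) (Sum.inl j) * Y (Sum.inl j) (Sum.inl i)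
      = ∑ i : Fin m, ∑ j : Fin m, Y (Sum.inl i) (Sum.inl j) * X (Sum.inl j) (Sum.inl i) := by
    rw [Finset.sum_comm]; simp only [mul_comm]
  have e2 : ∑ i : Fin n, ∑ j : Fin n, X (Sum.inr i) (Sum.inr j) * Y (Sum.inr j) (Sum.inr i)
      = ∑ i : Fin n, ∑ j : Fin n, Y (Sum.inr i) (Sum.inr j) * X (Sum.inr j) (Sum.inr i) := by
    rw [Finset.sum_comm]; simp only [mul_comm]
  simp [rhoOne, Matrix.mul_apply, Fintype.sum_prod_type, even_lr hX, even_lr hY, even_rl hX,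
    even_rl hY, Finset.sum_sub_distrib, ← Finset.mul_sum, e1, e2]

/-- The one-dimensional `𝔤₀`-module `ℂ_{-ρ₁}` of weight `-ρ₁`. -/
def negRhoOneRep (m n : ℕ) : g0 m n →ₗ⁅ℂ⁆ Module.End ℂ ℂ where
  toFun X := (- rhoOne X.1) • 1
  map_add' X Y := by
    ext; simp [rhoOne, Finset.sum_add_distrib, Finset.sum_sub_distrib]; ring
  map_smul' c X := by
    ext; simp [rhoOne, Finset.sum_sub_distrib, ← Finset.mul_sum]; ring
  map_lie' {X Y} := by
    ext
    have h := rhoOne_lie X.2 Y.2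
    simp [LieRing.of_associative_ring_bracket, h]; ring

/-- The Weil representation `M(𝔤₁)` as a `𝔤₀`-module, through `α`. -/
def weilRep (m n : ℕ) : g0 m n →ₗ⁅ℂ⁆ Module.End ℂ (PolyX m n) where
  toFun X := alphaOp X.1
  map_add' X Y := by
    have h : rhoOne (X.1 + Y.1) = rhoOne X.1 + rhoOne Y.1 := by
      simp [rhoOne, Finset.sum_add_distrib, Finset.sum_sub_distrib]; ring
    have h2 : adRep m n (X + Y) = adRep m n X + adRep m n Y := map_add _ _ _
    rw [alphaOp_eq X.2, alphaOp_eq Y.2, alphaOp_eq (X + Y).2]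
    change adRep m n (X + Y) - _ = adRep m n X - _ + (adRep m n Y - _)
    rw [h2]
    change _ - rhoOne (X.1 + Y.1) • _ = _
    rw [h, add_smul]; abel
  map_smul' c X := by
    have h : rhoOne (c • X.1) = c * rhoOne X.1 := by
      simp [rhoOne, Finset.sum_sub_distrib, ← Finset.mul_sum]; ring
    have h2 : adRep m n (c • X) = c • adRep m n X := map_smul _ _ _
    rw [alphaOp_eq X.2, alphaOp_eq (c • X).2]
    change adRep m n (c • X) - _ = c • (adRep m n X - _)
    rw [h2]
    change _ - rhoOne (c • X.1) • _ = _
    rw [h, smul_sub, smul_smul]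
  map_lie' {X Y} := by
    have h : rhoOne (⁅X, Y⁆ : g0 m n).1 = 0 := rhoOne_lie X.2 Y.2
    have h2 := (adRep m n).map_lie X Y
    rw [alphaOp_eq X.2, alphaOp_eq Y.2, alphaOp_eq (⁅X, Y⁆ : g0 m n).2]
    change adRep m n ⁅X, Y⁆ - _ = ⁅adRep m n X - _, adRep m n Y - _⁆
    rw [h2, h]
    simp only [LieRing.of_associative_ring_bracket]
    apply LinearMap.ext; intro f
    simp [Module.End.mul_apply]
    module

section Complexes

variable {V : Type*} [AddCommGroup V] [Module ℂ V]

/-- The operator `d = ∑ ∂_p ⊗ x_p` on `V ⊗ ℂ[x]`. -/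
def dOp (R : GLRep m n V) : Module.End ℂ (V ⊗[ℂ] PolyX m n) :=
  ∑ p : Fin m × Fin n, TensorProduct.map (R.act (dE p)) (mulX p)

/-- The operator `δ = ∑ x_p ⊗ ∂_p` on `V ⊗ ℂ[x]`. -/
def deltaOp (R : GLRep m n V) : Module.End ℂ (V ⊗[ℂ] PolyX m n) :=
  ∑ p : Fin m × Fin n, TensorProduct.map (R.act (xE p)) (dX p)

/-- The Dirac operator `D = 2 ∑ (∂_p ⊗ x_p - x_p ⊗ ∂_p)`, acting on `V ⊗ M(𝔤₁)`. -/
def diracOp (R : GLRep m n V) : Module.End ℂ (V ⊗[ℂ] PolyX m n) :=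
  (2 : ℂ) • ∑ p : Fin m × Fin n,
    (TensorProduct.map (R.act (dE p)) (mulX p) - TensorProduct.map (R.act (xE p)) (dX p))

/-- The `𝔤₀`-module `V ⊗ S(𝔤₋)`. -/
abbrev chainRep (R : GLRep m n V) : g0 m n →ₗ⁅ℂ⁆ Module.End ℂ (V ⊗[ℂ] PolyX m n) :=
  tensorRep R.even (adRep m n)

/-- The `𝔤₀`-module `V ⊗ M(𝔤₁)`, with the diagonal action `X ↦ X ⊗ 1 + 1 ⊗ α(X)`. -/
abbrev diagRep (R : GLRep m n V) : g0 m n →ₗ⁅ℂ⁆ Module.End ℂ (V ⊗[ℂ] PolyX m n) :=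
  tensorRep R.even (weilRep m n)

lemma chainRep_tmul (R : GLRep m n V) (X : g0 m n) (v : V) (f : PolyX m n) :
    chainRep R X (v ⊗ₜ f) = R.act X.1 v ⊗ₜ f + v ⊗ₜ adDer X.1 f := rfl

lemma diagRep_eq (R : GLRep m n V) (X : g0 m n) (w : V ⊗[ℂ] PolyX m n) :
    diagRep R X w = chainRep R X w - rhoOne X.1 • w := by
  induction w using TensorProduct.induction_on with
  | zero => simp
  | add a b ha hb => rw [map_add, map_add, ha, hb, smul_add]; abel
  | tmul v f =>
    rw [chainRep_tmul]
    change R.act X.1 v ⊗ₜ f + v ⊗ₜ alphaOp X.1 f = _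
    rw [alphaOp_eq X.2, LinearMap.sub_apply, TensorProduct.tmul_sub]
    simp [add_sub_assoc]

lemma dOp_comm (R : GLRep m n V) (X : g0 m n) (w : V ⊗[ℂ] PolyX m n) :
    dOp R (chainRep R X w) = chainRep R X (dOp R w) := by
  induction w using TensorProduct.induction_on with
  | zero => simp
  | add a b ha hb => simp only [map_add, ha, hb]
  | tmul v f =>
    have h1 : ∀ p, R.act (dE p) (R.act X.1 v)
        = R.act X.1 (R.act (dE p) v) + ∑ q, adCoef X.1 q p • R.act (dE q) v := by
      intro p
      have h := R.act_lie_even 1 X.2 (dE_mem p)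
      have h' := congrArg R.act (bracket_dE X.2 p)
      rw [← neg_sub, map_neg, h] at h'
      have h2 := LinearMap.congr_fun h' v
      simp only [map_sum, map_smul, LinearMap.sum_apply, LinearMap.smul_apply, LinearMap.neg_apply,
        LinearMap.sub_apply, Module.End.mul_apply] at h2
      rw [← h2]; abel
    simp only [chainRep_tmul, dOp, map_add, LinearMap.sum_apply, TensorProduct.map_tmul, map_sum,
      mulX, LinearMap.mulLeft_apply, h1, TensorProduct.add_tmul, TensorProduct.sum_tmul,
      Finset.sum_add_distrib, Derivation.leibniz, smul_eq_mul, adDer_X X.2, TensorProduct.tmul_add]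
    rw [add_assoc]
    congr 1
    rw [add_comm]
    congr 1
    rw [Finset.sum_comm]
    refine Finset.sum_congr rfl fun q _ => ?_
    rw [Finset.mul_sum, TensorProduct.tmul_sum]
    refine Finset.sum_congr rfl fun p _ => ?_
    rw [TensorProduct.smul_tmul, mul_smul_comm, mul_comm]

lemma pderiv_adDer {X : SGL m n} (hX : X ∈ glPart m n 0) (p : Fin m × Fin n) (f : PolyX m n) :
    MvPolynomial.pderiv p (adDer X f) = adDer X (MvPolynomial.pderiv p f)
      + ∑ q, adCoef X q p • MvPolynomial.pderiv q f := by
  have h : ⁅(MvPolynomial.pderiv p : Derivation ℂ (PolyX m n) (PolyX m n)), adDer X⁆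
      = ∑ q, adCoef X q p • (MvPolynomial.pderiv q : Derivation ℂ (PolyX m n) (PolyX m n)) := by
    refine MvPolynomial.derivation_ext fun r => ?_
    have e : ∀ a b : Fin m × Fin n, adDer X ((Pi.single a 1 : Fin m × Fin n → PolyX m n) b) = 0 := by
      intro a b
      by_cases hab : a = b
      · subst hab; simp
      · simp [Pi.single_eq_of_ne (Ne.symm hab)]
    rw [Derivation.commutator_apply, adDer_X hX, der_sum_apply]
    simp only [map_sum, Derivation.map_smul, MvPolynomial.pderiv_X, e, sub_zero]
    simp [Pi.single_apply, Finset.sum_ite_eq]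
  have h2 := congrArg (fun D : Derivation ℂ (PolyX m n) (PolyX m n) => D f) h
  simp only [Derivation.commutator_apply, der_sum_apply, Derivation.smul_apply] at h2
  rw [← h2]; abel

lemma deltaOp_comm (R : GLRep m n V) (X : g0 m n) (w : V ⊗[ℂ] PolyX m n) :
    deltaOp R (chainRep R X w) = chainRep R X (deltaOp R w) := by
  induction w using TensorProduct.induction_on with
  | zero => simp
  | add a b ha hb => simp only [map_add, ha, hb]
  | tmul v f =>
    have h1 : ∀ p, R.act X.1 (R.act (xE p) v)
        = R.act (xE p) (R.act X.1 v) + ∑ q, adCoef X.1 p q • R.act (xE q) v := by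
      intro p
      have h := R.act_lie_even 1 X.2 (xE_mem p)
      have h' := congrArg R.act (bracket_xE X.2 p)
      rw [bracket_even X.2 (xE_mem p), h] at h'
      have h2 := LinearMap.congr_fun h' v
      simp only [map_sum, map_smul, LinearMap.sum_apply, LinearMap.smul_apply,
        LinearMap.sub_apply, Module.End.mul_apply] at h2
      rw [← h2]; abel
    simp only [chainRep_tmul, deltaOp, map_add, LinearMap.sum_apply, TensorProduct.map_tmul,
      map_sum, dX, Derivation.coeFn_coe, h1, TensorProduct.add_tmul, TensorProduct.sum_tmul,
      Finset.sum_add_distrib, pderiv_adDer X.2, TensorProduct.tmul_add]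
    rw [add_assoc]
    congr 1
    rw [add_comm]
    congr 1
    rw [Finset.sum_comm]
    refine Finset.sum_congr rfl fun q _ => ?_
    rw [TensorProduct.tmul_sum]
    refine Finset.sum_congr rfl fun p _ => ?_
    rw [TensorProduct.smul_tmul]

lemma diracOp_comm (R : GLRep m n V) (X : g0 m n) (w : V ⊗[ℂ] PolyX m n) :
    diracOp R (diagRep R X w) = diagRep R X (diracOp R w) := by
  have h : diracOp R = (2 : ℂ) • (dOp R - deltaOp R) := by
    rw [diracOp, dOp, deltaOp, Finset.sum_sub_distrib]
  rw [h]
  simp only [diagRep_eq, LinearMap.smul_apply, LinearMap.sub_apply, map_sub, map_smul, dOp_comm,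
    deltaOp_comm]
  module

/-! ### Dirac cohomology -/

/-- The space `H_D(V) = Ker D / (Ker D ∩ Im D)`. -/
abbrev DiracCoh (R : GLRep m n V) :=
  SubQuot (LinearMap.ker (diracOp R)) (LinearMap.ker (diracOp R) ⊓ LinearMap.range (diracOp R))

/-- `H_D(V)` as a `𝔤₀`-module. -/
def diracCohRep (R : GLRep m n V) : g0 m n →ₗ⁅ℂ⁆ Module.End ℂ (DiracCoh R) :=
  subquotRep (diagRep R) _ _ (isStable_ker (diracOp R) (diracOp_comm R))
    (isStable_inf (isStable_ker (diracOp R) (diracOp_comm R))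
      (isStable_range (diracOp R) (diracOp_comm R)))

/-! ### Cohomology of `𝔤₊` and homology of `𝔤₋`

The cochains of degree `i` are `V ⊗ S^i(𝔤₊*)`, with `𝔤₊*` identified with `𝔤₋` by the pairing
`2B`, for which `∂_p` and `x_p` are dual bases; the chains of degree `i` are `V ⊗ S^i(𝔤₋)`. -/

/-- The subspace `V ⊗ S^i(𝔤₋)` of `V ⊗ S(𝔤₋)`. -/
def chains (V : Type*) [AddCommGroup V] [Module ℂ V] (m n i : ℕ) :
    Submodule ℂ (V ⊗[ℂ] PolyX m n) :=
  LinearMap.range (TensorProduct.map (LinearMap.id : V →ₗ[ℂ] V)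
    (MvPolynomial.homogeneousSubmodule (Fin m × Fin n) ℂ i).subtype)

lemma adDer_homog {X : SGL m n} (hX : X ∈ glPart m n 0) {i : ℕ} {f : PolyX m n}
    (hf : f ∈ MvPolynomial.homogeneousSubmodule (Fin m × Fin n) ℂ i) :
    adDer X f ∈ MvPolynomial.homogeneousSubmodule (Fin m × Fin n) ℂ i := by
  rw [adDer_apply hX]
  refine Submodule.sum_mem _ fun p _ => Submodule.sum_mem _ fun q _ => Submodule.smul_mem _ _ ?_
  rw [MvPolynomial.mem_homogeneousSubmodule] at hf ⊢
  rcases i with _ | i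
  · rw [← MvPolynomial.totalDegree_zero_iff_isHomogeneous,
      MvPolynomial.totalDegree_eq_zero_iff_eq_C] at hf
    rw [hf, MvPolynomial.pderiv_C, mul_zero]
    exact MvPolynomial.isHomogeneous_zero _ _ _
  · have := (MvPolynomial.isHomogeneous_X ℂ q).mul (hf.pderiv (i := p))
    rwa [Nat.add_sub_cancel, add_comm] at this

lemma isStable_chains (R : GLRep m n V) (i : ℕ) : IsStable (chainRep R) (chains V m n i) := by
  rintro X _ ⟨w, rfl⟩
  induction w using TensorProduct.induction_on with
  | zero => simp
  | add a b ha hb => rw [map_add, map_add]; exact Submodule.add_mem _ ha hb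
  | tmul v f =>
    rw [TensorProduct.map_tmul, chainRep_tmul]
    exact Submodule.add_mem _ ⟨R.act X.1 v ⊗ₜ f, rfl⟩ ⟨v ⊗ₜ ⟨_, adDer_homog X.2 f.2⟩, rfl⟩

/-- The cocycles of degree `i` for `d`. -/
def cocycles (R : GLRep m n V) (i : ℕ) : Submodule ℂ (V ⊗[ℂ] PolyX m n) :=
  LinearMap.ker (dOp R) ⊓ chains V m n i

/-- The coboundaries of degree `i`: the image under `d` of the cochains of degree `i - 1`. -/
def coboundaries (R : GLRep m n V) : ℕ → Submodule ℂ (V ⊗[ℂ] PolyX m n)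
  | 0 => ⊥
  | i + 1 => (chains V m n i).map (dOp R)

/-- The cycles of degree `i` for `δ`. -/
def cycles (R : GLRep m n V) (i : ℕ) : Submodule ℂ (V ⊗[ℂ] PolyX m n) :=
  LinearMap.ker (deltaOp R) ⊓ chains V m n i

/-- The boundaries of degree `i`: the image under `δ` of the chains of degree `i + 1`. -/
def boundaries (R : GLRep m n V) (i : ℕ) : Submodule ℂ (V ⊗[ℂ] PolyX m n) :=
  (chains V m n (i + 1)).map (deltaOp R)

lemma isStable_cocycles (R : GLRep m n V) (i : ℕ) : IsStable (chainRep R) (cocycles R i) :=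
  isStable_inf (isStable_ker (dOp R) (dOp_comm R)) (isStable_chains R i)

lemma isStable_coboundaries (R : GLRep m n V) :
    ∀ i, IsStable (chainRep R) (coboundaries R i)
  | 0 => by
    intro X v hv
    rw [coboundaries, Submodule.mem_bot] at hv
    rw [hv, map_zero]
    exact Submodule.zero_mem _
  | i + 1 => isStable_map (dOp R) (dOp_comm R) (isStable_chains R i)

lemma isStable_cycles (R : GLRep m n V) (i : ℕ) : IsStable (chainRep R) (cycles R i) :=
  isStable_inf (isStable_ker (deltaOp R) (deltaOp_comm R)) (isStable_chains R i)

lemma isStable_boundaries (R : GLRep m n V) (i : ℕ) : IsStable (chainRep R) (boundaries R i) :=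
  isStable_map (deltaOp R) (deltaOp_comm R) (isStable_chains R (i + 1))

/-- `H^i(𝔤₊, V)`. -/
abbrev GPlusCoh (R : GLRep m n V) (i : ℕ) :=
  SubQuot (cocycles R i) (coboundaries R i)

/-- `H_i(𝔤₋, V)`. -/
abbrev GMinusHom (R : GLRep m n V) (i : ℕ) :=
  SubQuot (cycles R i) (boundaries R i)

/-- `H^*(𝔤₊, V) = ⨁ H^i(𝔤₊, V)` as a `𝔤₀`-module. -/
def gPlusCohRep (R : GLRep m n V) :
    g0 m n →ₗ⁅ℂ⁆ Module.End ℂ (DirectSum ℕ fun i => GPlusCoh R i) :=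
  directSumRep fun i =>
    subquotRep (chainRep R) _ _ (isStable_cocycles R i) (isStable_coboundaries R i)

/-- `H_*(𝔤₋, V) = ⨁ H_i(𝔤₋, V)` as a `𝔤₀`-module. -/
def gMinusHomRep (R : GLRep m n V) :
    g0 m n →ₗ⁅ℂ⁆ Module.End ℂ (DirectSum ℕ fun i => GMinusHom R i) :=
  directSumRep fun i =>
    subquotRep (chainRep R) _ _ (isStable_cycles R i) (isStable_boundaries R i)

end Complexes

end

/-!
The operators `d` and `δ` satisfy `d² = δ² = 0`, and the argument is Hodge theory for the pair.

A contravariant positive definite form on `V`, extended to `V ⊗ ℂ[x]` by the Fischer form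
(`fischer`), makes `δ` the adjoint of `d` (`fischer_dOp`). By definiteness `δdw = 0` forces
`dw = 0` and `dδw = 0` forces `δw = 0`; from these two implications come
`Ker D = Ker d ∩ Ker δ = Ker (dδ + δd)` and all the disjointness statements.

Since `V` need not be complete or finite-dimensional, spanning requires that the Laplacian
`dδ + δd` be locally finite. It equals `∑ [∂_p, x_q] ⊗ x_p ∂/∂x_q + ∑ x_p ∂_p ⊗ 1`
(`laplacian_tmul`). The first sum acts on `V` through `𝔤₀`, and `∑ x_p ∂_p` commutes with `𝔤₀`, so
that it preserves the `𝔤₀`-isotypic components of `V`, which have finite dimension because the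
multiplicities are finite (`IsAdmissibleRep.exists_finiteDimensional_stable`). On a
finite-dimensional stable subspace the kernel and the range of the Laplacian are disjoint, hence
span, and therefore `Ker D`, `Im d`, `Im δ` span `V ⊗ ℂ[x]` (`GLRep.IsUnitary.sup_eq_top`).

For the isomorphisms, `Ker D ∩ Im D = 0` gives `H_D(V) = Ker D`. As `d` and `δ` are homogeneous,
`Ker D` is graded, and its part of degree `i` is a complement of the coboundaries in the cocycles,
and of the boundaries in the cycles (`repIso_gPlusCohRep`, `repIso_gMinusHomRep`). The twist by
`ℂ_{-ρ₁}` is the difference between `α` and the adjoint action (`repIso_diracCohRep`).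
-/

open scoped TensorProduct

noncomputable section

attribute [local instance] LieRing.ofAssociativeRing

variable {m n : ℕ}

/-! ### The Fischer form on `V ⊗ ℂ[x]` -/

section Fischer

variable {V : Type*} [AddCommGroup V] [Module ℂ V]

lemma tensor_monomial_induction {σ : Type*} {motive : V ⊗[ℂ] MvPolynomial σ ℂ → Prop}
    (u : V ⊗[ℂ] MvPolynomial σ ℂ) (add : ∀ u w, motive u → motive w → motive (u + w))
    (mono : ∀ v a, motive (v ⊗ₜ MvPolynomial.monomial a 1)) : motive u := by
  induction u using TensorProduct.induction_on with
  | zero => simpa using mono 0 0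
  | add u w hu hw => exact add u w hu hw
  | tmul v f =>
    induction f using MvPolynomial.induction_on' with
    | monomial a c =>
      have h : v ⊗ₜ[ℂ] MvPolynomial.monomial a c
          = (c • v) ⊗ₜ[ℂ] (MvPolynomial.monomial a 1 : MvPolynomial σ ℂ) := by
        rw [TensorProduct.smul_tmul, MvPolynomial.smul_monomial, smul_eq_mul, mul_one]
      rw [h]; exact mono _ _
    | add p q hp hq => rw [TensorProduct.tmul_add]; exact add _ _ hp hq

/-- The coefficients in `V` of an element of `V ⊗ ℂ[x]`. -/
def tensorCoeff (V σ : Type*) [AddCommGroup V] [Module ℂ V] :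
    V ⊗[ℂ] MvPolynomial σ ℂ ≃ₗ[ℂ] (σ →₀ ℕ) →₀ V :=
  haveI := Classical.decEq (σ →₀ ℕ)
  TensorProduct.equivFinsuppOfBasisRight (MvPolynomial.basisMonomials σ ℂ)

lemma tensorCoeff_monomial {σ : Type*} (v : V) (a : σ →₀ ℕ) :
    tensorCoeff V σ (v ⊗ₜ MvPolynomial.monomial a 1) = Finsupp.single a v := by
  let _ := Classical.decEq (σ →₀ ℕ)
  have hb : (MvPolynomial.basisMonomials σ ℂ).repr (MvPolynomial.monomial a 1)
      = Finsupp.single a 1 := by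
    rw [← (MvPolynomial.basisMonomials σ ℂ).repr_self a, MvPolynomial.coe_basisMonomials]
  refine (TensorProduct.equivFinsuppOfBasisRight_apply_tmul
    (MvPolynomial.basisMonomials σ ℂ) v (MvPolynomial.monomial a 1)).trans ?_
  rw [hb]
  simp

/-- The factorial `∏ a_p!` of an exponent. -/
def multiFactorial {σ : Type*} (a : σ →₀ ℕ) : ℕ := a.prod fun _ k => k.factorial

lemma multiFactorial_pos {σ : Type*} (a : σ →₀ ℕ) : 0 < multiFactorial a :=
  Finset.prod_pos fun _ _ => Nat.factorial_pos _

lemma multiFactorial_add_single {σ : Type*} [Fintype σ] [DecidableEq σ] (a : σ →₀ ℕ) (p : σ) :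
    multiFactorial (a + Finsupp.single p 1) = (a p + 1) * multiFactorial a := by
  unfold multiFactorial
  rw [Finsupp.prod_fintype _ _ (by simp), Finsupp.prod_fintype _ _ (by simp),
    ← Finset.mul_prod_erase _ _ (Finset.mem_univ p),
    ← Finset.mul_prod_erase (a := p) _ (fun i => (a i).factorial) (Finset.mem_univ p)]
  rw [← mul_assoc]
  congr 1
  · simp [Nat.factorial_succ]
  · refine Finset.prod_congr rfl fun q hq => ?_
    simp [(Finset.ne_of_mem_erase hq).symm]

/-- The extension of a sesquilinear form on `V` to `V ⊗ ℂ[x]` by the Fischer form on `ℂ[x]`: the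
monomials are orthogonal, and `⟨x^a, x^a⟩ = a!`, which makes `∂/∂x_p` the adjoint of `x_p`. -/
def fischer {σ : Type*} (h : V →ₗ⋆[ℂ] V →ₗ[ℂ] ℂ) (u w : V ⊗[ℂ] MvPolynomial σ ℂ) : ℂ :=
  (tensorCoeff V σ u).sum fun a v => multiFactorial a * h v (tensorCoeff V σ w a)

variable {σ : Type*} (h : V →ₗ⋆[ℂ] V →ₗ[ℂ] ℂ)

lemma fischer_add_left (u u' w : V ⊗[ℂ] MvPolynomial σ ℂ) :
    fischer h (u + u') w = fischer h u w + fischer h u' w := by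
  rw [fischer, map_add, Finsupp.sum_add_index'] <;> simp [fischer, mul_add]

lemma fischer_add_right (u w w' : V ⊗[ℂ] MvPolynomial σ ℂ) :
    fischer h u (w + w') = fischer h u w + fischer h u w' := by
  simp [fischer, mul_add, Finsupp.sum_add]

lemma fischer_zero_right (u : V ⊗[ℂ] MvPolynomial σ ℂ) : fischer h u 0 = 0 := by
  simp [fischer]

lemma fischer_smul_right (c : ℂ) (u w : V ⊗[ℂ] MvPolynomial σ ℂ) :
    fischer h u (c • w) = c * fischer h u w := by
  simp [fischer, mul_left_comm, Finsupp.sum, Finset.mul_sum]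

lemma fischer_sum_left {ι : Type*} (s : Finset ι) (u : ι → V ⊗[ℂ] MvPolynomial σ ℂ)
    (w : V ⊗[ℂ] MvPolynomial σ ℂ) : fischer h (∑ i ∈ s, u i) w = ∑ i ∈ s, fischer h (u i) w :=
  map_sum (AddMonoidHom.mk' (fun u => fischer h u w) fun u u' => fischer_add_left h u u' w) u s

lemma fischer_sum_right {ι : Type*} (s : Finset ι) (u : V ⊗[ℂ] MvPolynomial σ ℂ)
    (w : ι → V ⊗[ℂ] MvPolynomial σ ℂ) : fischer h u (∑ i ∈ s, w i) = ∑ i ∈ s, fischer h u (w i) :=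
  map_sum (AddMonoidHom.mk' (fun w => fischer h u w) fun w w' => fischer_add_right h u w w') w s

lemma fischer_monomial [DecidableEq σ] (v w : V) (a b : σ →₀ ℕ) :
    fischer h (v ⊗ₜ MvPolynomial.monomial a 1) (w ⊗ₜ MvPolynomial.monomial b 1)
      = if a = b then multiFactorial a * h v w else 0 := by
  rw [fischer, tensorCoeff_monomial, tensorCoeff_monomial, Finsupp.sum_single_index (by simp)]
  by_cases hab : a = b
  · simp [hab]
  · simp [hab]

lemma fischer_symm (hs : ∀ v w, starRingEnd ℂ (h v w) = h w v) (u w : V ⊗[ℂ] MvPolynomial σ ℂ) :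
    starRingEnd ℂ (fischer h u w) = fischer h w u := by
  classical
  induction u using tensor_monomial_induction with
  | add u u' hu hu' => rw [fischer_add_left, fischer_add_right, map_add, hu, hu']
  | mono v a =>
    induction w using tensor_monomial_induction with
    | add w w' hw hw' => rw [fischer_add_left, fischer_add_right, map_add, hw, hw']
    | mono w b =>
      rw [fischer_monomial, fischer_monomial]
      by_cases hab : a = b
      · simp [hab, hs]
      · simp [hab, Ne.symm hab]

lemma fischer_definite (hp : ∀ v, v ≠ 0 → 0 < (h v v).re) {u : V ⊗[ℂ] MvPolynomial σ ℂ}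
    (hu : fischer h u u = 0) : u = 0 := by
  have h0 := congrArg Complex.re hu
  rw [fischer, Finsupp.sum, Complex.re_sum, Complex.zero_re] at h0
  have hpos : ∀ a ∈ (tensorCoeff V σ u).support,
      0 < ((multiFactorial a : ℂ) * h (tensorCoeff V σ u a) (tensorCoeff V σ u a)).re := by
    intro a ha
    rw [← Complex.ofReal_natCast, Complex.re_ofReal_mul]
    exact mul_pos (Nat.cast_pos.mpr (multiFactorial_pos a)) (hp _ (Finsupp.mem_support_iff.mp ha))
  rw [Finset.sum_eq_zero_iff_of_nonneg fun a ha => (hpos a ha).le] at h0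
  have he : (tensorCoeff V σ u).support = ∅ :=
    Finset.eq_empty_of_forall_notMem fun a ha => (hpos a ha).ne' (h0 a ha)
  rw [Finsupp.support_eq_empty] at he
  simpa using he

end Fischer

/-! ### `d` and `δ` are adjoint differentials -/

section Adjoint

variable {V : Type*} [AddCommGroup V] [Module ℂ V] (R : GLRep m n V)

lemma dE_conjTranspose (p : Fin m × Fin n) : (dE p).conjTranspose = xE p := by
  simp [dE, xE, Matrix.conjTranspose_single]

lemma dOp_tmul (v : V) (f : PolyX m n) :
    dOp R (v ⊗ₜ f) = ∑ p, R.act (dE p) v ⊗ₜ (MvPolynomial.X p * f) := by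
  simp [dOp, mulX]

lemma deltaOp_tmul (v : V) (f : PolyX m n) :
    deltaOp R (v ⊗ₜ f) = ∑ p, R.act (xE p) v ⊗ₜ MvPolynomial.pderiv p f := by
  simp [deltaOp, dX]

lemma diracOp_apply (w : V ⊗[ℂ] PolyX m n) :
    diracOp R w = (2 : ℂ) • (dOp R w - deltaOp R w) := by
  simp [diracOp, dOp, deltaOp]

/-- Contravariance makes `δ` the adjoint of `d`: the adjoint of `∂_p` on `V` is `x_p`, and that of
`x_p` on `ℂ[x]` is `∂/∂x_p`. -/
lemma fischer_dOp {h : V →ₗ⋆[ℂ] V →ₗ[ℂ] ℂ}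
    (hc : ∀ (X : SGL m n) (v w : V), h (R.act X v) w = h v (R.act X.conjTranspose w))
    (u w : V ⊗[ℂ] PolyX m n) : fischer h (dOp R u) w = fischer h u (deltaOp R w) := by
  induction u using tensor_monomial_induction with
  | add u u' hu hu' => rw [map_add, fischer_add_left, fischer_add_left, hu, hu']
  | mono v a =>
    induction w using tensor_monomial_induction with
    | add w w' hw hw' => rw [map_add, fischer_add_right, fischer_add_right, hw, hw']
    | mono w b =>
      rw [dOp_tmul, deltaOp_tmul, fischer_sum_left, fischer_sum_right]
      refine Finset.sum_congr rfl fun p _ => ?_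
      have hX : (MvPolynomial.X p * MvPolynomial.monomial a 1 : PolyX m n)
          = MvPolynomial.monomial (a + Finsupp.single p 1) 1 := by
        rw [MvPolynomial.X, MvPolynomial.monomial_mul, one_mul, add_comm]
      have hd : (MvPolynomial.pderiv p (MvPolynomial.monomial b 1) : PolyX m n)
          = (b p : ℂ) • MvPolynomial.monomial (b - Finsupp.single p 1) 1 := by
        rw [MvPolynomial.pderiv_monomial, MvPolynomial.smul_monomial, smul_eq_mul, one_mul, mul_one]
      rw [hX, hd, TensorProduct.tmul_smul, fischer_smul_right, fischer_monomial, fischer_monomial,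
        hc, dE_conjTranspose]
      -- both sides vanish unless `b = a + e_p`, and then `b! = b_p a!`
      by_cases hb : b p = 0
      · have : a + Finsupp.single p 1 ≠ b := by
          rintro rfl
          simp at hb
        simp [hb, this]
      · have hle : Finsupp.single p 1 ≤ b := by
          rw [Finsupp.single_le_iff]; omega
        obtain ⟨c, rfl⟩ := exists_add_of_le hle
        rw [add_comm _ c, add_tsub_cancel_right]
        by_cases hac : a = c
        · subst hac
          simp [multiFactorial_add_single]
          ring
        · simp [hac]

lemma fischer_deltaOp {h : V →ₗ⋆[ℂ] V →ₗ[ℂ] ℂ} (hs : ∀ v w, starRingEnd ℂ (h v w) = h w v)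
    (hc : ∀ (X : SGL m n) (v w : V), h (R.act X v) w = h v (R.act X.conjTranspose w))
    (u w : V ⊗[ℂ] PolyX m n) : fischer h (deltaOp R u) w = fischer h u (dOp R w) := by
  rw [← fischer_symm h hs, ← fischer_dOp R hc, fischer_symm h hs]

lemma eq_zero_of_eq_neg_self {E : Type*} [AddCommGroup E] [Module ℂ E] {x : E} (h : x = -x) :
    x = 0 := by
  have h2 : (2 : ℂ) • x = 0 := by rw [two_smul]; nth_rw 2 [h]; exact add_neg_cancel x
  exact (smul_eq_zero.mp h2).resolve_left two_ne_zero

lemma pderiv_comm {σ : Type*} (p q : σ) (f : MvPolynomial σ ℂ) :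
    MvPolynomial.pderiv p (MvPolynomial.pderiv q f)
      = MvPolynomial.pderiv q (MvPolynomial.pderiv p f) := by
  classical
  have h : ⁅(MvPolynomial.pderiv p : Derivation ℂ (MvPolynomial σ ℂ) (MvPolynomial σ ℂ)),
      (MvPolynomial.pderiv q : Derivation ℂ (MvPolynomial σ ℂ) (MvPolynomial σ ℂ))⁆ = 0 := by
    refine MvPolynomial.derivation_ext fun r => ?_
    rw [Derivation.commutator_apply, MvPolynomial.pderiv_X, MvPolynomial.pderiv_X]
    simp only [Pi.single_apply]
    split_ifs <;> simp
  have h' := congrArg (fun D : Derivation ℂ (MvPolynomial σ ℂ) (MvPolynomial σ ℂ) => D f) h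
  rwa [Derivation.commutator_apply, Derivation.zero_apply, sub_eq_zero] at h'

lemma act_dE_dE (p q : Fin m × Fin n) (v : V) :
    R.act (dE p) (R.act (dE q) v) = - R.act (dE q) (R.act (dE p) v) := by
  have h := R.act_bracket 1 1 _ (dE_mem p) _ (dE_mem q)
  rw [bracket_dE_dE, map_zero] at h
  have h' := LinearMap.congr_fun h v
  simp [superSign] at h'
  exact eq_neg_of_add_eq_zero_left h'.symm

lemma act_xE_xE (p q : Fin m × Fin n) (v : V) :
    R.act (xE p) (R.act (xE q) v) = - R.act (xE q) (R.act (xE p) v) := by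
  have h := R.act_bracket 1 1 _ (xE_mem p) _ (xE_mem q)
  rw [bracket_xE_xE, map_zero] at h
  have h' := LinearMap.congr_fun h v
  simp [superSign] at h'
  exact eq_neg_of_add_eq_zero_left h'.symm

/-- The `∂_p` anticommute on `V` and the `x_p` commute on `ℂ[x]`, so that exchanging the two
summation indices changes the sign. -/
lemma dOp_dOp (w : V ⊗[ℂ] PolyX m n) : dOp R (dOp R w) = 0 := by
  induction w using TensorProduct.induction_on with
  | zero => simp
  | add a b ha hb => rw [map_add, map_add, ha, hb, add_zero]
  | tmul v f =>
    refine eq_zero_of_eq_neg_self ?_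
    simp only [dOp_tmul, map_sum]
    conv_lhs => rw [Finset.sum_comm]
    simp only [← Finset.sum_neg_distrib]
    refine Finset.sum_congr rfl fun p _ => Finset.sum_congr rfl fun q _ => ?_
    rw [act_dE_dE, TensorProduct.neg_tmul, mul_left_comm]

/-- The `x_p` anticommute on `V` and the `∂/∂x_p` commute on `ℂ[x]`. -/
lemma deltaOp_deltaOp (w : V ⊗[ℂ] PolyX m n) : deltaOp R (deltaOp R w) = 0 := by
  induction w using TensorProduct.induction_on with
  | zero => simp
  | add a b ha hb => rw [map_add, map_add, ha, hb, add_zero]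
  | tmul v f =>
    refine eq_zero_of_eq_neg_self ?_
    simp only [deltaOp_tmul, map_sum]
    conv_lhs => rw [Finset.sum_comm]
    simp only [← Finset.sum_neg_distrib]
    refine Finset.sum_congr rfl fun p _ => Finset.sum_congr rfl fun q _ => ?_
    rw [act_xE_xE, TensorProduct.neg_tmul, pderiv_comm]

end Adjoint

/-! ### Local finiteness of intertwining operators -/

section Isotypic

variable {L : Type*} [LieRing L] [LieAlgebra ℂ L]

lemma RepIso.symm {E F : Type*} [AddCommGroup E] [Module ℂ E] [AddCommGroup F] [Module ℂ F]
    {ρ : L →ₗ⁅ℂ⁆ Module.End ℂ E} {σ : L →ₗ⁅ℂ⁆ Module.End ℂ F} (h : RepIso ρ σ) : RepIso σ ρ := by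
  obtain ⟨φ, hφ⟩ := h
  exact ⟨φ.symm, fun X v => by rw [LinearEquiv.symm_apply_eq, hφ, φ.apply_symm_apply]⟩

lemma RepIso.trans {E F G : Type*} [AddCommGroup E] [Module ℂ E] [AddCommGroup F] [Module ℂ F]
    [AddCommGroup G] [Module ℂ G] {ρ : L →ₗ⁅ℂ⁆ Module.End ℂ E} {σ : L →ₗ⁅ℂ⁆ Module.End ℂ F}
    {τ : L →ₗ⁅ℂ⁆ Module.End ℂ G} (h : RepIso ρ σ) (h' : RepIso σ τ) : RepIso ρ τ := by
  obtain ⟨φ, hφ⟩ := h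
  obtain ⟨ψ, hψ⟩ := h'
  exact ⟨φ.trans ψ, fun X v => by simp [hφ, hψ]⟩

/-- Schur's lemma. -/
lemma IsSimpleRep.repIso_of_ne_zero {E F : Type*} [AddCommGroup E] [Module ℂ E] [AddCommGroup F]
    [Module ℂ F] {ρ : L →ₗ⁅ℂ⁆ Module.End ℂ E} {σ : L →ₗ⁅ℂ⁆ Module.End ℂ F}
    (hρ : IsSimpleRep ρ) (hσ : IsSimpleRep σ) (T : E →ₗ[ℂ] F)
    (hT : ∀ X v, T (ρ X v) = σ X (T v)) (h0 : T ≠ 0) : RepIso ρ σ := by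
  have hk : LinearMap.ker T = ⊥ := (hρ.2 _ (isStable_ker T hT)).resolve_right fun h =>
    h0 (LinearMap.ker_eq_top.mp h)
  have hst : IsStable σ (LinearMap.range T) := by
    rintro X _ ⟨v, rfl⟩
    exact ⟨ρ X v, hT X v⟩
  have hr : LinearMap.range T = ⊤ := (hσ.2 _ hst).resolve_left fun h =>
    h0 (LinearMap.range_eq_bot.mp h)
  exact ⟨LinearEquiv.ofBijective T ⟨LinearMap.ker_eq_bot.mp hk, LinearMap.range_eq_top.mp hr⟩, hT⟩

/-- An intertwining operator of an admissible representation is locally finite: it preserves the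
isotypic components, which are finite-dimensional. -/
lemma IsAdmissibleRep.exists_finiteDimensional_stable {E : Type*} [AddCommGroup E] [Module ℂ E]
    {ρ : L →ₗ⁅ℂ⁆ Module.End ℂ E} (hρ : IsAdmissibleRep ρ) (T : Module.End ℂ E)
    (hT : ∀ X v, T (ρ X v) = ρ X (T v)) (v : E) :
    ∃ U : Submodule ℂ E, FiniteDimensional ℂ U ∧ IsStable ρ U ∧ (∀ u ∈ U, T u ∈ U) ∧ v ∈ U := by
  classical
  obtain ⟨S, hS, hind, hsup, hsimple, hfin⟩ := hρ
  let A : S → Submodule ℂ E := fun W => W.1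
  have hint : DirectSum.IsInternal A :=
    DirectSum.isInternal_submodule_of_iSupIndep_of_iSup_eq_top
      ((sSupIndep_iff S).mp hind) (by rw [← hsup, sSup_eq_iSup'])
  let e := LinearEquiv.ofBijective (DirectSum.coeLinearMap A) hint
  have he : ∀ f, e.symm (DirectSum.coeLinearMap A f) = f := e.symm_apply_apply
  have heA : ∀ x, DirectSum.coeLinearMap A (e.symm x) = x := e.apply_symm_apply
  -- taking components is equivariant
  have hcomp : ∀ X x W, e.symm (ρ X x) W = subRep ρ W.1 (hS W) X (e.symm x W) := by
    intro X x W
    have h1 : ∀ f, DirectSum.coeLinearMap A (DirectSum.lmap (fun W : S => subRep ρ W.1 (hS W) X) f)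
        = ρ X (DirectSum.coeLinearMap A f) := by
      intro f
      induction f using DirectSum.induction_on with
      | zero => simp
      | add a b ha hb => simp only [map_add, ha, hb]
      | of W w =>
        change DirectSum.coeLinearMap A (DirectSum.lmap _ (DirectSum.lof ℂ S (fun W => A W) W w))
          = ρ X (DirectSum.coeLinearMap A (DirectSum.lof ℂ S (fun W => A W) W w))
        rw [DirectSum.lmap_lof, DirectSum.coeLinearMap_lof, DirectSum.coeLinearMap_lof]
        rfl
    have h2 := he (DirectSum.lmap (fun W : S => subRep ρ W.1 (hS W) X) (e.symm x))
    rw [h1, heA] at h2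
    rw [h2, DirectSum.lmap_apply]
  -- the summands isomorphic to one that meets `v`
  let I : Set S := ⋃ W ∈ (e.symm v).support,
    {W' : S | RepIso (subRep ρ W.1 (hS W)) (subRep ρ W'.1 (hS W'))}
  have hI : I.Finite := Set.Finite.biUnion (Finset.finite_toSet _) fun W _ => hfin W
  have hmem : ∀ x : E, (∀ W, e.symm x W ≠ 0 → W ∈ I) → x ∈ ⨆ W : I, A W := by
    intro x hx
    rw [← heA x, DirectSum.coeLinearMap_eq_dfinsuppSum]
    refine Submodule.sum_mem _ fun W hW => ?_
    exact Submodule.mem_iSup_of_mem (⟨W, hx W (DFinsupp.mem_support_iff.mp hW)⟩ : I)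
      (e.symm x W).2
  have := hI.to_subtype
  have : ∀ W : I, FiniteDimensional ℂ (A W) := fun W => (hsimple W).1
  refine ⟨⨆ W : I, A W, Submodule.finiteDimensional_iSup _, ?_, ?_, ?_⟩
  · intro X x hx
    induction hx using Submodule.iSup_induction' with
    | mem W x hx => exact Submodule.mem_iSup_of_mem W (hS W X x hx)
    | zero => simp
    | add x y _ _ hx hy => rw [map_add]; exact Submodule.add_mem _ hx hy
  · intro x hx
    induction hx using Submodule.iSup_induction' with
    | mem W x hx =>
      refine hmem _ fun W' hW' => ?_
      obtain ⟨W₀, hW₀, hiso⟩ := Set.mem_iUnion₂.mp W.2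
      refine Set.mem_iUnion₂.mpr ⟨W₀, hW₀, RepIso.trans hiso ?_⟩
      let f : W.1.1 →ₗ[ℂ] W'.1 :=
        (DirectSum.component ℂ S (fun W => A W) W') ∘ₗ e.symm.toLinearMap ∘ₗ T ∘ₗ W.1.1.subtype
      refine (hsimple W).2.repIso_of_ne_zero (hsimple W').2 f ?_ fun h => hW' ?_
      · intro X w
        change e.symm (T (ρ X w)) W' = _
        rw [hT, hcomp]
        rfl
      · exact LinearMap.congr_fun h ⟨x, hx⟩
    | zero => simp
    | add x y _ _ hx hy => rw [map_add]; exact Submodule.add_mem _ hx hy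
  · exact hmem v fun W hW => Set.mem_iUnion₂.mpr
      ⟨W, DFinsupp.mem_support_iff.mpr hW, LinearEquiv.refl _ _, fun _ _ => rfl⟩

end Isotypic

/-! ### The Laplacian -/

section Laplacian

variable {V : Type*} [AddCommGroup V] [Module ℂ V] (R : GLRep m n V)

/-- The action on `V` of the `𝔤₀`-invariant element `∑ x_p ∂_p` of `U(𝔤)`. -/
def oddCasimir : Module.End ℂ V := ∑ p : Fin m × Fin n, R.act (xE p) * R.act (dE p)

lemma act_even_xE {X : SGL m n} (hX : X ∈ glPart m n 0) (p : Fin m × Fin n) (v : V) :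
    R.act X (R.act (xE p) v) = R.act (xE p) (R.act X v) + ∑ q, adCoef X p q • R.act (xE q) v := by
  have h' := congrArg R.act (bracket_xE hX p)
  rw [bracket_even hX (xE_mem p), R.act_lie_even 1 hX (xE_mem p)] at h'
  have h2 := LinearMap.congr_fun h' v
  simp only [map_sum, map_smul, LinearMap.sum_apply, LinearMap.smul_apply,
    LinearMap.sub_apply, Module.End.mul_apply] at h2
  rw [← h2]; abel

lemma act_even_dE {X : SGL m n} (hX : X ∈ glPart m n 0) (p : Fin m × Fin n) (v : V) :
    R.act X (R.act (dE p) v) = R.act (dE p) (R.act X v) - ∑ q, adCoef X q p • R.act (dE q) v := by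
  have h' := congrArg R.act (bracket_dE hX p)
  rw [← neg_sub, map_neg, R.act_lie_even 1 hX (dE_mem p)] at h'
  have h2 := LinearMap.congr_fun h' v
  simp only [map_sum, map_smul, LinearMap.sum_apply, LinearMap.smul_apply, LinearMap.neg_apply,
    LinearMap.sub_apply, Module.End.mul_apply] at h2
  rw [← h2]; abel

lemma oddCasimir_comm (X : g0 m n) (v : V) :
    oddCasimir R (R.even X v) = R.even X (oddCasimir R v) := by
  change oddCasimir R (R.act X.1 v) = R.act X.1 (oddCasimir R v)
  simp only [oddCasimir, LinearMap.sum_apply, Module.End.mul_apply, map_sum, act_even_xE R X.2,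
    act_even_dE R X.2, map_sub, map_smul, Finset.sum_add_distrib, Finset.sum_sub_distrib]
  rw [Finset.sum_comm (f := fun p q => adCoef X.1 q p • R.act (xE p) (R.act (dE q) v))]
  abel

lemma bracket_dE_xE_mem (p q : Fin m × Fin n) : superBracket (dE p) (xE q) ∈ glPart m n 0 := by
  rw [bracket_odd (dE_mem p) (xE_mem q)]
  intro i j h
  rcases i with i | i <;> rcases j with j | j <;>
    simp_all [dE, xE, par, Matrix.mul_apply, Matrix.single_apply]
  · exact absurd rfl h

/-- The Laplacian `dδ + δd`; up to the factor `-4` it is `D²`. -/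
def laplacian : Module.End ℂ (V ⊗[ℂ] PolyX m n) := dOp R * deltaOp R + deltaOp R * dOp R

lemma laplacian_apply (w : V ⊗[ℂ] PolyX m n) :
    laplacian R w = dOp R (deltaOp R w) + deltaOp R (dOp R w) := rfl

/-- The Laplacian is `∑ [∂_p, x_q] ⊗ x_p ∂/∂x_q + ∑ x_p ∂_p ⊗ 1`: it acts on `V` by `𝔤₀` and the
`𝔤₀`-invariant `∑ x_p ∂_p`, and it preserves the degree in `ℂ[x]`. -/
lemma laplacian_tmul (v : V) (f : PolyX m n) :
    laplacian R (v ⊗ₜ f) = ∑ p, ∑ q, R.act (superBracket (dE p) (xE q)) v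
        ⊗ₜ (MvPolynomial.X p * MvPolynomial.pderiv q f) + oddCasimir R v ⊗ₜ f := by
  have h1 : ∀ p q, R.act (superBracket (dE p) (xE q)) v
      = R.act (dE p) (R.act (xE q) v) + R.act (xE q) (R.act (dE p) v) := by
    intro p q
    rw [R.act_bracket 1 1 _ (dE_mem p) _ (xE_mem q)]
    simp [superSign]
  have h2 : ∀ p q : Fin m × Fin n, MvPolynomial.pderiv q (MvPolynomial.X p * f)
      = MvPolynomial.X p * MvPolynomial.pderiv q f + if p = q then f else 0 := by
    intro p q
    rw [Derivation.leibniz, MvPolynomial.pderiv_X]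
    by_cases h : p = q
    · subst h; simp
    · simp [h]
  have h3 : oddCasimir R v ⊗ₜ[ℂ] f = ∑ p : Fin m × Fin n, ∑ q : Fin m × Fin n,
      R.act (xE q) (R.act (dE p) v) ⊗ₜ[ℂ] (if p = q then f else 0) := by
    simp [oddCasimir, TensorProduct.sum_tmul, TensorProduct.tmul_ite]
  rw [laplacian_apply, dOp_tmul, deltaOp_tmul, h3]
  simp only [map_sum, dOp_tmul, deltaOp_tmul, h1, h2, TensorProduct.tmul_add,
    TensorProduct.add_tmul, Finset.sum_add_distrib]
  rw [Finset.sum_comm]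
  abel

lemma X_mul_pderiv_homog {σ : Type*} (p q : σ) {i : ℕ} {f : MvPolynomial σ ℂ}
    (hf : f ∈ MvPolynomial.homogeneousSubmodule σ ℂ i) :
    MvPolynomial.X p * MvPolynomial.pderiv q f ∈ MvPolynomial.homogeneousSubmodule σ ℂ i := by
  rw [MvPolynomial.mem_homogeneousSubmodule] at hf ⊢
  rcases i with _ | i
  · rw [← MvPolynomial.totalDegree_zero_iff_isHomogeneous,
      MvPolynomial.totalDegree_eq_zero_iff_eq_C] at hf
    rw [hf, MvPolynomial.pderiv_C, mul_zero]
    exact MvPolynomial.isHomogeneous_zero _ _ _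
  · have := (MvPolynomial.isHomogeneous_X ℂ p).mul (hf.pderiv (i := q))
    rwa [Nat.add_sub_cancel, add_comm] at this

/-- The Laplacian is locally finite: `U ⊗ S^i(𝔤₋)` is stable for each finite-dimensional
`U ⊆ V` stable under `𝔤₀` and `∑ x_p ∂_p`. -/
lemma exists_finiteDimensional_laplacian_stable (hrel : R.IsRelModule) (v : V) {i : ℕ}
    {f : PolyX m n} (hf : f ∈ MvPolynomial.homogeneousSubmodule (Fin m × Fin n) ℂ i) :
    ∃ W : Submodule ℂ (V ⊗[ℂ] PolyX m n), FiniteDimensional ℂ W ∧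
      (∀ w ∈ W, laplacian R w ∈ W) ∧ v ⊗ₜ f ∈ W := by
  obtain ⟨U, hU, hst, hC, hv⟩ :=
    IsAdmissibleRep.exists_finiteDimensional_stable hrel (oddCasimir R) (oddCasimir_comm R) v
  have : FiniteDimensional ℂ (MvPolynomial.homogeneousSubmodule (Fin m × Fin n) ℂ i) :=
    Module.Finite.iff_fg.mpr (MvPolynomial.homogeneousSubmodule_fg _ _ i)
  refine ⟨LinearMap.range (TensorProduct.map U.subtype
    (MvPolynomial.homogeneousSubmodule (Fin m × Fin n) ℂ i).subtype), inferInstance, ?_,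
    ⟨⟨v, hv⟩ ⊗ₜ ⟨f, hf⟩, rfl⟩⟩
  rintro _ ⟨w, rfl⟩
  induction w using TensorProduct.induction_on with
  | zero => simp
  | add a b ha hb => rw [map_add, map_add]; exact Submodule.add_mem _ ha hb
  | tmul u g =>
    rw [TensorProduct.map_tmul, laplacian_tmul]
    refine Submodule.add_mem _ (Submodule.sum_mem _ fun p _ => Submodule.sum_mem _ fun q _ => ?_) ?_
    · exact ⟨⟨_, hst ⟨_, bracket_dE_xE_mem p q⟩ u u.2⟩ ⊗ₜ ⟨_, X_mul_pderiv_homog p q g.2⟩, rfl⟩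
    · exact ⟨⟨_, hC u u.2⟩ ⊗ₜ g, rfl⟩

end Laplacian

/-- On the finite-dimensional `W`, a kernel and a range that are disjoint span, by rank-nullity. -/
lemma mem_ker_sup_range_of_finiteDimensional_stable {E : Type*} [AddCommGroup E] [Module ℂ E]
    (T : Module.End ℂ E) (hT : Disjoint (LinearMap.ker T) (LinearMap.range T))
    (W : Submodule ℂ E) [FiniteDimensional ℂ W] (hW : ∀ w ∈ W, T w ∈ W) {w : E} (hw : w ∈ W) :
    w ∈ LinearMap.ker T ⊔ LinearMap.range T := by
  have hd : Disjoint (LinearMap.ker (T.restrict hW)) (LinearMap.range (T.restrict hW)) := by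
    rw [Submodule.disjoint_def] at hT ⊢
    rintro x hx ⟨y, rfl⟩
    exact Subtype.ext (hT _ (congrArg Subtype.val hx) ⟨y, rfl⟩)
  have htop := Submodule.eq_top_of_disjoint _ _
    (by rw [add_comm, LinearMap.finrank_range_add_finrank_ker]) hd
  have hmem : (⟨w, hw⟩ : W) ∈ LinearMap.ker (T.restrict hW) ⊔ LinearMap.range (T.restrict hW) :=
    htop ▸ Submodule.mem_top
  obtain ⟨k, hk, _, ⟨u, rfl⟩, h⟩ := Submodule.mem_sup.mp hmem
  exact Submodule.mem_sup.mpr ⟨k, congrArg Subtype.val hk, _, ⟨u, rfl⟩, congrArg Subtype.val h⟩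

/-! ### The Hodge decomposition -/

section Hodge

variable {V : Type*} [AddCommGroup V] [Module ℂ V] {R : GLRep m n V}

/-- This is `‖dw‖² = ⟨w, δdw⟩`. -/
lemma GLRep.IsUnitary.dOp_eq_zero (hu : R.IsUnitary) {w : V ⊗[ℂ] PolyX m n}
    (hw : deltaOp R (dOp R w) = 0) : dOp R w = 0 := by
  obtain ⟨h, hs, hp, hc⟩ := hu
  exact fischer_definite h hp (by rw [fischer_dOp R hc, hw, fischer_zero_right])

/-- This is `‖δw‖² = ⟨w, dδw⟩`. -/
lemma GLRep.IsUnitary.deltaOp_eq_zero (hu : R.IsUnitary) {w : V ⊗[ℂ] PolyX m n}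
    (hw : dOp R (deltaOp R w) = 0) : deltaOp R w = 0 := by
  obtain ⟨h, hs, hp, hc⟩ := hu
  exact fischer_definite h hp (by rw [fischer_deltaOp R hs hc, hw, fischer_zero_right])

lemma GLRep.IsUnitary.ker_diracOp (hu : R.IsUnitary) :
    LinearMap.ker (diracOp R) = LinearMap.ker (dOp R) ⊓ LinearMap.ker (deltaOp R) := by
  ext w
  rw [Submodule.mem_inf, LinearMap.mem_ker, LinearMap.mem_ker, LinearMap.mem_ker, diracOp_apply]
  constructor
  · intro h
    have h' : dOp R w = deltaOp R w :=
      sub_eq_zero.mp ((smul_eq_zero.mp h).resolve_left two_ne_zero)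
    have h0 : dOp R w = 0 := hu.dOp_eq_zero (by rw [h', deltaOp_deltaOp])
    exact ⟨h0, h'.symm.trans h0⟩
  · rintro ⟨h, h'⟩
    rw [h, h', sub_zero, smul_zero]

/-- If `dδw + δdw = 0`, then applying `d` and `δ` gives `dδdw = 0` and `δdδw = 0`, and definiteness
removes the outer operators one at a time. -/
lemma GLRep.IsUnitary.ker_laplacian_le (hu : R.IsUnitary) :
    LinearMap.ker (laplacian R) ≤ LinearMap.ker (diracOp R) := by
  intro w hw
  rw [LinearMap.mem_ker, laplacian_apply] at hw
  rw [hu.ker_diracOp]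
  have h1 := congrArg (dOp R) hw
  have h2 := congrArg (deltaOp R) hw
  rw [map_add, dOp_dOp, zero_add, map_zero] at h1
  rw [map_add, deltaOp_deltaOp, add_zero, map_zero] at h2
  exact ⟨hu.dOp_eq_zero (hu.deltaOp_eq_zero h1), hu.deltaOp_eq_zero (hu.dOp_eq_zero h2)⟩

lemma GLRep.IsUnitary.disjoint_laplacian (hu : R.IsUnitary) :
    Disjoint (LinearMap.ker (laplacian R)) (LinearMap.range (laplacian R)) := by
  rw [Submodule.disjoint_def]
  rintro _ hx ⟨u, rfl⟩
  have h := hu.ker_laplacian_le hx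
  rw [hu.ker_diracOp] at h
  obtain ⟨h1, h2⟩ := h
  rw [SetLike.mem_coe, LinearMap.mem_ker, laplacian_apply, map_add] at h1 h2
  rw [dOp_dOp, zero_add] at h1
  rw [deltaOp_deltaOp, add_zero] at h2
  rw [laplacian_apply, hu.deltaOp_eq_zero h1, hu.dOp_eq_zero h2, add_zero]

/-- The Laplacian is locally finite, and its kernel meets its range trivially; so on each
finite-dimensional stable subspace the kernel and the range span. -/
lemma GLRep.IsUnitary.sup_eq_top (hu : R.IsUnitary) (hrel : R.IsRelModule) :
    LinearMap.ker (diracOp R) ⊔ LinearMap.range (dOp R) ⊔ LinearMap.range (deltaOp R) = ⊤ := by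
  have hle : LinearMap.ker (laplacian R) ⊔ LinearMap.range (laplacian R)
      ≤ LinearMap.ker (diracOp R) ⊔ LinearMap.range (dOp R) ⊔ LinearMap.range (deltaOp R) := by
    refine sup_le (hu.ker_laplacian_le.trans (le_sup_left.trans le_sup_left)) ?_
    rintro _ ⟨u, rfl⟩
    rw [laplacian_apply]
    exact Submodule.add_mem _ (Submodule.mem_sup_left (Submodule.mem_sup_right ⟨_, rfl⟩))
      (Submodule.mem_sup_right ⟨_, rfl⟩)
  rw [eq_top_iff]
  intro w _
  induction w using TensorProduct.induction_on with
  | zero => exact Submodule.zero_mem _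
  | add a b ha hb => exact Submodule.add_mem _ (ha trivial) (hb trivial)
  | tmul v f =>
    rw [← MvPolynomial.sum_homogeneousComponent f, TensorProduct.tmul_sum]
    refine Submodule.sum_mem _ fun i _ => hle ?_
    obtain ⟨W, hW, hst, hmem⟩ := exists_finiteDimensional_laplacian_stable R hrel v
      (MvPolynomial.homogeneousComponent_mem i f)
    exact mem_ker_sup_range_of_finiteDimensional_stable _ hu.disjoint_laplacian W hst hmem

lemma GLRep.IsUnitary.exists_decomp (hu : R.IsUnitary) (hrel : R.IsRelModule)
    (w : V ⊗[ℂ] PolyX m n) :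
    ∃ k ∈ LinearMap.ker (diracOp R), ∃ u u', w = k + dOp R u + deltaOp R u' := by
  have h : w ∈ LinearMap.ker (diracOp R) ⊔ LinearMap.range (dOp R) ⊔ LinearMap.range (deltaOp R) :=
    hu.sup_eq_top hrel ▸ Submodule.mem_top
  obtain ⟨_, hy, _, ⟨u', rfl⟩, rfl⟩ := Submodule.mem_sup.mp h
  obtain ⟨k, hk, _, ⟨u, rfl⟩, rfl⟩ := Submodule.mem_sup.mp hy
  exact ⟨k, hk, u, u', rfl⟩

lemma GLRep.IsUnitary.disjoint_range_dOp (hu : R.IsUnitary) :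
    Disjoint (LinearMap.ker (diracOp R)) (LinearMap.range (dOp R)) := by
  rw [Submodule.disjoint_def, hu.ker_diracOp]
  rintro _ hx ⟨u, rfl⟩
  exact hu.dOp_eq_zero hx.2

lemma GLRep.IsUnitary.disjoint_range_deltaOp (hu : R.IsUnitary) :
    Disjoint (LinearMap.ker (diracOp R)) (LinearMap.range (deltaOp R)) := by
  rw [Submodule.disjoint_def, hu.ker_diracOp]
  rintro _ hx ⟨u, rfl⟩
  exact hu.deltaOp_eq_zero hx.1

lemma GLRep.IsUnitary.disjoint_range_diracOp (hu : R.IsUnitary) :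
    Disjoint (LinearMap.ker (diracOp R)) (LinearMap.range (diracOp R)) := by
  rw [Submodule.disjoint_def, hu.ker_diracOp]
  rintro _ hx ⟨u, rfl⟩
  obtain ⟨h1, h2⟩ := hx
  rw [SetLike.mem_coe, LinearMap.mem_ker, diracOp_apply, map_smul, map_sub] at h1 h2
  rw [dOp_dOp, zero_sub, smul_eq_zero_iff_right two_ne_zero, neg_eq_zero] at h1
  rw [deltaOp_deltaOp, sub_zero, smul_eq_zero_iff_right two_ne_zero] at h2
  rw [diracOp_apply, hu.deltaOp_eq_zero h1, hu.dOp_eq_zero h2, sub_zero, smul_zero]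

lemma GLRep.IsUnitary.ker_dOp (hu : R.IsUnitary) (hrel : R.IsRelModule) :
    LinearMap.ker (dOp R) = LinearMap.ker (diracOp R) ⊔ LinearMap.range (dOp R) := by
  refine le_antisymm (fun w hw => ?_) (sup_le ?_ ?_)
  · obtain ⟨k, hk, u, u', rfl⟩ := hu.exists_decomp hrel w
    have hk' := hk
    rw [hu.ker_diracOp] at hk'
    rw [LinearMap.mem_ker, map_add, map_add, LinearMap.mem_ker.mp hk'.1, dOp_dOp, zero_add,
      zero_add] at hw
    rw [hu.deltaOp_eq_zero hw, add_zero]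
    exact Submodule.add_mem_sup hk ⟨u, rfl⟩
  · rw [hu.ker_diracOp]; exact inf_le_left
  · rintro _ ⟨u, rfl⟩
    exact dOp_dOp R u

lemma GLRep.IsUnitary.ker_deltaOp (hu : R.IsUnitary) (hrel : R.IsRelModule) :
    LinearMap.ker (deltaOp R) = LinearMap.ker (diracOp R) ⊔ LinearMap.range (deltaOp R) := by
  refine le_antisymm (fun w hw => ?_) (sup_le ?_ ?_)
  · obtain ⟨k, hk, u, u', rfl⟩ := hu.exists_decomp hrel w
    have hk' := hk
    rw [hu.ker_diracOp] at hk'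
    rw [LinearMap.mem_ker, map_add, map_add, LinearMap.mem_ker.mp hk'.2, deltaOp_deltaOp, zero_add,
      add_zero] at hw
    rw [hu.dOp_eq_zero hw, add_zero]
    exact Submodule.add_mem_sup hk ⟨u', rfl⟩
  · rw [hu.ker_diracOp]; exact inf_le_right
  · rintro _ ⟨u, rfl⟩
    exact deltaOp_deltaOp R u

lemma GLRep.IsUnitary.isInternal (hu : R.IsUnitary) (hrel : R.IsRelModule) :
    DirectSum.IsInternal
      ![LinearMap.ker (diracOp R), LinearMap.range (dOp R), LinearMap.range (deltaOp R)] := by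
  refine DirectSum.isInternal_submodule_of_iSupIndep_of_iSup_eq_top ?_ ?_
  · rw [iSupIndep_fin_three]
    simp only [Matrix.cons_val]
    refine ⟨?_, ?_, ?_⟩
    · rw [Submodule.disjoint_def, hu.ker_diracOp]
      rintro _ ⟨h1, h2⟩ hx
      obtain ⟨_, ⟨u, rfl⟩, _, ⟨u', rfl⟩, rfl⟩ := Submodule.mem_sup.mp hx
      rw [SetLike.mem_coe, LinearMap.mem_ker, map_add] at h1 h2
      rw [dOp_dOp, zero_add] at h1
      rw [deltaOp_deltaOp, add_zero] at h2
      rw [hu.deltaOp_eq_zero h1, hu.dOp_eq_zero h2, add_zero]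
    · rw [sup_comm, ← hu.ker_deltaOp hrel, Submodule.disjoint_def]
      rintro _ ⟨u, rfl⟩ hx
      exact hu.dOp_eq_zero hx
    · rw [← hu.ker_dOp hrel, Submodule.disjoint_def]
      rintro _ ⟨u, rfl⟩ hx
      exact hu.deltaOp_eq_zero hx
  · rw [← hu.sup_eq_top hrel, iSup_fin_three]
    rfl

end Hodge

/-! ### The grading by degree in `S(𝔤₋)` -/

section Grading

variable {V : Type*} [AddCommGroup V] [Module ℂ V] (R : GLRep m n V)

/-- The projection of `V ⊗ S(𝔤₋)` to `V ⊗ S^i(𝔤₋)`. -/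
def chainComp (V : Type*) [AddCommGroup V] [Module ℂ V] (m n i : ℕ) :
    Module.End ℂ (V ⊗[ℂ] PolyX m n) :=
  TensorProduct.map LinearMap.id (MvPolynomial.homogeneousComponent i)

lemma tmul_mem_chains (v : V) {i : ℕ} {f : PolyX m n}
    (hf : f ∈ MvPolynomial.homogeneousSubmodule (Fin m × Fin n) ℂ i) :
    v ⊗ₜ f ∈ chains V m n i := ⟨v ⊗ₜ ⟨f, hf⟩, rfl⟩

lemma chains_induction {i : ℕ} {motive : V ⊗[ℂ] PolyX m n → Prop} {w : V ⊗[ℂ] PolyX m n}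
    (hw : w ∈ chains V m n i) (zero : motive 0)
    (add : ∀ u w, motive u → motive w → motive (u + w))
    (tmul : ∀ v f, f ∈ MvPolynomial.homogeneousSubmodule (Fin m × Fin n) ℂ i →
      motive (v ⊗ₜ f)) : motive w := by
  obtain ⟨w, rfl⟩ := hw
  induction w using TensorProduct.induction_on with
  | zero => rwa [map_zero]
  | add a b ha hb => rw [map_add]; exact add _ _ ha hb
  | tmul v f => exact tmul v f f.2

lemma chainComp_mem (i : ℕ) (w : V ⊗[ℂ] PolyX m n) : chainComp V m n i w ∈ chains V m n i := by
  induction w using TensorProduct.induction_on with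
  | zero => rw [map_zero]; exact Submodule.zero_mem _
  | add a b ha hb => rw [map_add]; exact Submodule.add_mem _ ha hb
  | tmul v f => exact tmul_mem_chains v (MvPolynomial.homogeneousComponent_mem i f)

lemma chainComp_of_mem {i j : ℕ} {w : V ⊗[ℂ] PolyX m n} (hw : w ∈ chains V m n j) :
    chainComp V m n i w = if i = j then w else 0 := by
  refine chains_induction
    (motive := fun w => chainComp V m n i w = if i = j then w else 0) hw
    (by simp) (fun a b ha hb => ?_) fun v f hf => ?_
  · rw [map_add, ha, hb]; split_ifs <;> simp
  · rw [chainComp, TensorProduct.map_tmul, MvPolynomial.homogeneousComponent_of_mem hf]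
    by_cases h : j = i
    · subst h; simp
    · simp [Ne.symm h]

lemma iSup_chains : ⨆ i, chains V m n i = ⊤ := by
  rw [eq_top_iff]
  intro w _
  induction w using TensorProduct.induction_on with
  | zero => exact Submodule.zero_mem _
  | add a b ha hb => exact Submodule.add_mem _ (ha trivial) (hb trivial)
  | tmul v f =>
    rw [← MvPolynomial.sum_homogeneousComponent f, TensorProduct.tmul_sum]
    exact Submodule.sum_mem _ fun i _ => Submodule.mem_iSup_of_mem i
      (tmul_mem_chains v (MvPolynomial.homogeneousComponent_mem i f))

lemma iSupIndep_chains : iSupIndep (chains V m n) := by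
  intro i
  rw [Submodule.disjoint_def]
  intro w hw hw'
  have hle : ⨆ j, ⨆ (_ : j ≠ i), chains V m n j ≤ LinearMap.ker (chainComp V m n i) :=
    iSup₂_le fun j hj u hu => by rw [LinearMap.mem_ker, chainComp_of_mem hu, if_neg hj.symm]
  have h := chainComp_of_mem (i := i) hw
  rw [if_pos rfl] at h
  rw [← h]
  exact hle hw'

lemma dOp_mem_chains {i : ℕ} {w : V ⊗[ℂ] PolyX m n} (hw : w ∈ chains V m n i) :
    dOp R w ∈ chains V m n (i + 1) := by
  refine chains_induction
    (motive := fun w => dOp R w ∈ chains V m n (i + 1)) hw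
    (by simp) (fun a b ha hb => ?_) fun v f hf => ?_
  · rw [map_add]; exact Submodule.add_mem _ ha hb
  · rw [dOp_tmul]
    refine Submodule.sum_mem _ fun p _ => tmul_mem_chains _ ?_
    have h := (MvPolynomial.isHomogeneous_X ℂ p).mul hf
    rwa [add_comm] at h

lemma deltaOp_mem_chains {i : ℕ} {w : V ⊗[ℂ] PolyX m n} (hw : w ∈ chains V m n (i + 1)) :
    deltaOp R w ∈ chains V m n i := by
  refine chains_induction
    (motive := fun w => deltaOp R w ∈ chains V m n i) hw
    (by simp) (fun a b ha hb => ?_) fun v f hf => ?_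
  · rw [map_add]; exact Submodule.add_mem _ ha hb
  · rw [deltaOp_tmul]
    exact Submodule.sum_mem _ fun p _ => tmul_mem_chains _ (MvPolynomial.IsHomogeneous.pderiv hf)

lemma deltaOp_of_mem_chains_zero {w : V ⊗[ℂ] PolyX m n} (hw : w ∈ chains V m n 0) :
    deltaOp R w = 0 := by
  refine chains_induction
    (motive := fun w => deltaOp R w = 0) hw
    (by simp) (fun a b ha hb => ?_) fun v f hf => ?_
  · rw [map_add, ha, hb, add_zero]
  · rw [MvPolynomial.mem_homogeneousSubmodule, ← MvPolynomial.totalDegree_zero_iff_isHomogeneous,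
      MvPolynomial.totalDegree_eq_zero_iff_eq_C] at hf
    rw [deltaOp_tmul, hf]
    simp

lemma graded_induction {motive : V ⊗[ℂ] PolyX m n → Prop} (w : V ⊗[ℂ] PolyX m n)
    (zero : motive 0) (add : ∀ u w, motive u → motive w → motive (u + w))
    (mem : ∀ i, ∀ w ∈ chains V m n i, motive w) : motive w :=
  Submodule.iSup_induction (chains V m n) (motive := motive)
    (iSup_chains (V := V) ▸ Submodule.mem_top)
    mem zero add

lemma chainComp_succ_dOp (i : ℕ) (w : V ⊗[ℂ] PolyX m n) :
    chainComp V m n (i + 1) (dOp R w) = dOp R (chainComp V m n i w) := by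
  refine graded_induction
    (motive := fun w => chainComp V m n (i + 1) (dOp R w) = dOp R (chainComp V m n i w)) w
    (by simp) (fun a b ha hb => by simp only [map_add, ha, hb])
    fun j w hw => ?_
  rw [chainComp_of_mem hw, chainComp_of_mem (dOp_mem_chains R hw)]
  by_cases h : i = j <;> simp [h]

lemma chainComp_zero_dOp (w : V ⊗[ℂ] PolyX m n) : chainComp V m n 0 (dOp R w) = 0 := by
  refine graded_induction
    (motive := fun w => chainComp V m n 0 (dOp R w) = 0) w
    (by simp) (fun a b ha hb => by simp only [map_add, ha, hb, add_zero])
    fun j w hw => ?_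
  rw [chainComp_of_mem (dOp_mem_chains R hw), if_neg (Nat.succ_ne_zero j).symm]

lemma chainComp_deltaOp (i : ℕ) (w : V ⊗[ℂ] PolyX m n) :
    chainComp V m n i (deltaOp R w) = deltaOp R (chainComp V m n (i + 1) w) := by
  refine graded_induction
    (motive := fun w => chainComp V m n i (deltaOp R w) = deltaOp R (chainComp V m n (i + 1) w)) w
    (by simp) (fun a b ha hb => by simp only [map_add, ha, hb])
    fun j w hw => ?_
  rcases j with _ | j
  · rw [chainComp_of_mem hw, deltaOp_of_mem_chains_zero R hw]
    simp
  · rw [chainComp_of_mem hw, chainComp_of_mem (deltaOp_mem_chains R hw)]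
    by_cases h : i = j <;> simp [h]

/-- An element is the finite sum of its homogeneous components. -/
lemma mem_iSup_of_chainComp_mem {K : Submodule ℂ (V ⊗[ℂ] PolyX m n)} {w : V ⊗[ℂ] PolyX m n}
    (hw : ∀ i, chainComp V m n i w ∈ K) : w ∈ ⨆ i, K ⊓ chains V m n i := by
  have h : ∃ N, ∀ M ≥ N, w = ∑ i ∈ Finset.range M, chainComp V m n i w := by
    clear hw
    induction w using graded_induction with
    | zero => exact ⟨0, by simp⟩
    | add a b ha hb =>
      obtain ⟨N, hN⟩ := ha
      obtain ⟨N', hN'⟩ := hb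
      refine ⟨max N N', fun M hM => ?_⟩
      simp only [map_add, Finset.sum_add_distrib]
      rw [← hN M (le_of_max_le_left hM), ← hN' M (le_of_max_le_right hM)]
    | mem j w hw =>
      refine ⟨j + 1, fun M hM => ?_⟩
      simp only [chainComp_of_mem hw]
      rw [Finset.sum_ite_eq', if_pos (Finset.mem_range.mpr hM)]
  obtain ⟨N, hN⟩ := h
  rw [hN N le_rfl]
  exact Submodule.sum_mem _ fun i _ => Submodule.mem_iSup_of_mem i ⟨hw i, chainComp_mem i w⟩

variable {R}

lemma GLRep.IsUnitary.chainComp_mem_ker (hu : R.IsUnitary) {w : V ⊗[ℂ] PolyX m n}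
    (hw : w ∈ LinearMap.ker (diracOp R)) (i : ℕ) :
    chainComp V m n i w ∈ LinearMap.ker (diracOp R) := by
  rw [hu.ker_diracOp] at hw ⊢
  refine ⟨?_, ?_⟩
  · rw [SetLike.mem_coe, LinearMap.mem_ker, ← chainComp_succ_dOp, LinearMap.mem_ker.mp hw.1,
      map_zero]
  · rcases i with _ | i
    · exact deltaOp_of_mem_chains_zero R (chainComp_mem 0 w)
    · rw [SetLike.mem_coe, LinearMap.mem_ker, ← chainComp_deltaOp, LinearMap.mem_ker.mp hw.2,
        map_zero]

lemma GLRep.IsUnitary.iSup_ker_inf_chains (hu : R.IsUnitary) :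
    ⨆ i, LinearMap.ker (diracOp R) ⊓ chains V m n i = LinearMap.ker (diracOp R) :=
  le_antisymm (iSup_le fun _ => inf_le_left) fun _ hw =>
    mem_iSup_of_chainComp_mem (hu.chainComp_mem_ker hw)

lemma coboundaries_le_range (i : ℕ) : coboundaries R i ≤ LinearMap.range (dOp R) := by
  rcases i with _ | i
  · exact bot_le
  · exact LinearMap.map_le_range

lemma chainComp_dOp_mem_coboundaries (i : ℕ) (u : V ⊗[ℂ] PolyX m n) :
    chainComp V m n i (dOp R u) ∈ coboundaries R i := by
  rcases i with _ | i
  · rw [chainComp_zero_dOp]; exact Submodule.zero_mem _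
  · rw [chainComp_succ_dOp]
    exact ⟨_, chainComp_mem i u, rfl⟩

lemma GLRep.IsUnitary.cocycles_le (hu : R.IsUnitary) (hrel : R.IsRelModule) (i : ℕ) :
    cocycles R i ≤ (LinearMap.ker (diracOp R) ⊓ chains V m n i) ⊔ coboundaries R i := by
  rintro w ⟨hw, hi⟩
  have h := chainComp_of_mem (i := i) hi
  rw [if_pos rfl] at h
  rw [SetLike.mem_coe, hu.ker_dOp hrel] at hw
  obtain ⟨k, hk, _, ⟨u, rfl⟩, rfl⟩ := Submodule.mem_sup.mp hw
  rw [← h, map_add]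
  exact Submodule.add_mem_sup ⟨hu.chainComp_mem_ker hk i, chainComp_mem i k⟩
    (chainComp_dOp_mem_coboundaries i u)

lemma GLRep.IsUnitary.cycles_le (hu : R.IsUnitary) (hrel : R.IsRelModule) (i : ℕ) :
    cycles R i ≤ (LinearMap.ker (diracOp R) ⊓ chains V m n i) ⊔ boundaries R i := by
  rintro w ⟨hw, hi⟩
  have h := chainComp_of_mem (i := i) hi
  rw [if_pos rfl] at h
  rw [SetLike.mem_coe, hu.ker_deltaOp hrel] at hw
  obtain ⟨k, hk, _, ⟨u, rfl⟩, rfl⟩ := Submodule.mem_sup.mp hw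
  rw [← h, map_add, chainComp_deltaOp]
  exact Submodule.add_mem_sup ⟨hu.chainComp_mem_ker hk i, chainComp_mem i k⟩
    ⟨_, chainComp_mem (i + 1) u, rfl⟩

end Grading

/-! ### Constructions of isomorphisms of representations -/

section RepIsos

variable {L : Type*} [LieRing L] [LieAlgebra ℂ L]

lemma RepIso.directSum {E F : ℕ → Type*} [∀ i, AddCommGroup (E i)] [∀ i, Module ℂ (E i)]
    [∀ i, AddCommGroup (F i)] [∀ i, Module ℂ (F i)] {ρ : ∀ i, L →ₗ⁅ℂ⁆ Module.End ℂ (E i)}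
    {σ : ∀ i, L →ₗ⁅ℂ⁆ Module.End ℂ (F i)} (h : ∀ i, RepIso (ρ i) (σ i)) :
    RepIso (directSumRep ρ) (directSumRep σ) := by
  choose φ hφ using h
  refine ⟨DirectSum.congrLinearEquiv φ, fun X v => ?_⟩
  refine DFinsupp.ext fun i => ?_
  exact hφ i X (v i)

lemma RepIso.tensor_right {E F G : Type*} [AddCommGroup E] [Module ℂ E] [AddCommGroup F]
    [Module ℂ F] [AddCommGroup G] [Module ℂ G] {ρ : L →ₗ⁅ℂ⁆ Module.End ℂ E}
    {σ : L →ₗ⁅ℂ⁆ Module.End ℂ F} (h : RepIso ρ σ) (τ : L →ₗ⁅ℂ⁆ Module.End ℂ G) :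
    RepIso (tensorRep ρ τ) (tensorRep σ τ) := by
  obtain ⟨φ, hφ⟩ := h
  refine ⟨TensorProduct.congr φ (LinearEquiv.refl ℂ G), fun X v => ?_⟩
  induction v using TensorProduct.induction_on with
  | zero => simp
  | add a b ha hb => simp only [map_add, ha, hb]
  | tmul v g => simp [tensorRep, hφ]

variable {E : Type*} [AddCommGroup E] [Module ℂ E] {ρ : L →ₗ⁅ℂ⁆ Module.End ℂ E}

/-- A stable complement of `B` in `Z` represents the subquotient. -/
lemma repIso_subRep_subquotRep {A Z B : Submodule ℂ E} (hA : IsStable ρ A) (hZ : IsStable ρ Z)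
    (hB : IsStable ρ B) (hAZ : A ≤ Z) (hAB : Disjoint A B) (hZAB : Z ≤ A ⊔ B) :
    RepIso (subRep ρ A hA) (subquotRep ρ Z B hZ hB) := by
  have hmk : ∀ z : Z, SubQuot.mk Z B z = 0 ↔ (z : E) ∈ B := fun z =>
    Submodule.Quotient.mk_eq_zero (B.submoduleOf Z)
  let f : A →ₗ[ℂ] SubQuot Z B := SubQuot.mk Z B ∘ₗ Submodule.inclusion hAZ
  have hf : Function.Bijective f := by
    constructor
    · rw [← LinearMap.ker_eq_bot, LinearMap.ker_eq_bot']
      intro a ha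
      exact Subtype.ext (Submodule.disjoint_def.mp hAB _ a.2 ((hmk _).mp ha))
    · intro x
      obtain ⟨z, rfl⟩ := Submodule.mkQ_surjective _ x
      obtain ⟨a, ha, b, hb, hab⟩ := Submodule.mem_sup.mp (hZAB z.2)
      refine ⟨⟨a, ha⟩, ?_⟩
      change SubQuot.mk Z B ⟨a, hAZ ha⟩ = SubQuot.mk Z B z
      rw [← sub_eq_zero, ← map_sub, hmk, Submodule.coe_sub, ← hab]
      simpa using hb
  exact ⟨LinearEquiv.ofBijective f hf, fun X v => rfl⟩

/-- A representation is the external direct sum of the stable subspaces in a decomposition of it. -/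
lemma repIso_directSumRep_subRep {A : ℕ → Submodule ℂ E} {K : Submodule ℂ E}
    (hA : ∀ i, IsStable ρ (A i)) (hK : IsStable ρ K) (hind : iSupIndep A) (hsup : ⨆ i, A i = K) :
    RepIso (directSumRep fun i => subRep ρ (A i) (hA i)) (subRep ρ K hK) := by
  refine ⟨(LinearEquiv.ofInjective (DirectSum.coeLinearMap A) hind.dfinsupp_lsum_injective).trans
    (LinearEquiv.ofEq _ _ (DirectSum.range_coeLinearMap.trans hsup)), fun X v => Subtype.ext ?_⟩
  change DirectSum.coeLinearMap A (directSumRep _ X v) = ρ X (DirectSum.coeLinearMap A v)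
  induction v using DirectSum.induction_on with
  | zero => simp
  | add a b ha hb => simp only [map_add, ha, hb]
  | of i w =>
    change DirectSum.coeLinearMap A (DirectSum.lmap _ (DirectSum.lof ℂ ℕ (fun i => A i) i w))
      = ρ X (DirectSum.coeLinearMap A (DirectSum.lof ℂ ℕ (fun i => A i) i w))
    rw [DirectSum.lmap_lof, DirectSum.coeLinearMap_lof, DirectSum.coeLinearMap_lof]
    rfl

end RepIsos

/-! ### Harmonic representatives -/

section Comparison

variable {V : Type*} [AddCommGroup V] [Module ℂ V] {R : GLRep m n V}

lemma isStable_ker_diracOp (R : GLRep m n V) :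
    IsStable (chainRep R) (LinearMap.ker (diracOp R)) :=
  isStable_ker _ fun X w => by
    rw [diracOp_apply, diracOp_apply, dOp_comm, deltaOp_comm, ← map_sub, ← map_smul]

/-- The diagonal action through `α` is the one through `ad`, twisted by `-ρ₁`. -/
lemma repIso_diracCohRep (hu : R.IsUnitary) :
    RepIso (diracCohRep R)
      (tensorRep (subRep (chainRep R) _ (isStable_ker_diracOp R)) (negRhoOneRep m n)) := by
  have hst : IsStable (diagRep R) (LinearMap.ker (diracOp R)) :=
    isStable_ker (diracOp R) (diracOp_comm R)
  have h1 : RepIso (subRep (diagRep R) _ hst) (diracCohRep R) :=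
    repIso_subRep_subquotRep hst _ _ le_rfl
      (hu.disjoint_range_diracOp.mono_right inf_le_right) le_sup_left
  refine h1.symm.trans (RepIso.symm ⟨TensorProduct.rid ℂ _, fun X w => ?_⟩)
  induction w using TensorProduct.induction_on with
  | zero => simp
  | add a b ha hb => simp only [map_add, ha, hb]
  | tmul k c =>
    apply Subtype.ext
    change _ = diagRep R X ((TensorProduct.rid ℂ _ (k ⊗ₜ c) : _) : V ⊗[ℂ] PolyX m n)
    rw [diagRep_eq]
    simp [tensorRep, negRhoOneRep, subRep]
    module

/-- Every class in `H^*(𝔤₊, V)` has a unique harmonic representative, that is, one in `Ker D`. -/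
lemma repIso_gPlusCohRep (hu : R.IsUnitary) (hrel : R.IsRelModule) :
    RepIso (subRep (chainRep R) _ (isStable_ker_diracOp R)) (gPlusCohRep R) := by
  have hst := fun i => isStable_inf (isStable_ker_diracOp R) (isStable_chains R i)
  refine (repIso_directSumRep_subRep hst _ (iSupIndep_chains.mono fun _ => inf_le_right)
    hu.iSup_ker_inf_chains).symm.trans (RepIso.directSum fun i => ?_)
  refine repIso_subRep_subquotRep _ _ _ (inf_le_inf_right _ ?_) ?_ (hu.cocycles_le hrel i)
  · rw [hu.ker_diracOp]; exact inf_le_left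
  · exact hu.disjoint_range_dOp.mono inf_le_left (coboundaries_le_range i)

/-- Every class in `H_*(𝔤₋, V)` has a unique representative in `Ker D`. -/
lemma repIso_gMinusHomRep (hu : R.IsUnitary) (hrel : R.IsRelModule) :
    RepIso (subRep (chainRep R) _ (isStable_ker_diracOp R)) (gMinusHomRep R) := by
  have hst := fun i => isStable_inf (isStable_ker_diracOp R) (isStable_chains R i)
  refine (repIso_directSumRep_subRep hst _ (iSupIndep_chains.mono fun _ => inf_le_right)
    hu.iSup_ker_inf_chains).symm.trans (RepIso.directSum fun i => ?_)
  refine repIso_subRep_subquotRep _ _ _ (inf_le_inf_right _ ?_) ?_ (hu.cycles_le hrel i)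
  · rw [hu.ker_diracOp]; exact inf_le_right
  · exact hu.disjoint_range_deltaOp.mono inf_le_left LinearMap.map_le_range

end Comparison

end

theorem mainTheorem1 (m n : ℕ) {V : Type*} [AddCommGroup V] [Module ℂ V] (R : GLRep m n V)
    (hrel : R.IsRelModule) (hirr : R.IsIrred) (hunit : R.IsUnitary) :
    DirectSum.IsInternal
        ![LinearMap.ker (diracOp R), LinearMap.range (dOp R), LinearMap.range (deltaOp R)] ∧
    (Disjoint (LinearMap.ker (diracOp R)) (LinearMap.range (dOp R)) ∧
      LinearMap.ker (dOp R) = LinearMap.ker (diracOp R) ⊔ LinearMap.range (dOp R)) ∧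
    (Disjoint (LinearMap.ker (diracOp R)) (LinearMap.range (deltaOp R)) ∧
      LinearMap.ker (deltaOp R) = LinearMap.ker (diracOp R) ⊔ LinearMap.range (deltaOp R)) ∧
    RepIso (diracCohRep R) (tensorRep (gPlusCohRep R) (negRhoOneRep m n)) ∧
    RepIso (tensorRep (gPlusCohRep R) (negRhoOneRep m n))
      (tensorRep (gMinusHomRep R) (negRhoOneRep m n)) := by
  have hp := repIso_gPlusCohRep hunit hrel
  have hm := repIso_gMinusHomRep hunit hrel
  exact ⟨hunit.isInternal hrel, ⟨hunit.disjoint_range_dOp, hunit.ker_dOp hrel⟩,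
    ⟨hunit.disjoint_range_deltaOp, hunit.ker_deltaOp hrel⟩,
    (repIso_diracCohRep hunit).trans (hp.tensor_right _),
    (hp.symm.trans hm).tensor_right _⟩
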